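/- **Posets.** All posets $\mathcal P$ are finite, have a unique minimal element $\hat 0$, and are ranked: for each $x$ all maximal chains among those with greatest element $x$ have the same length $\operatorname{rk}(x)$. Put $\operatorname{rk}(\mathcal P)=\max_x\operatorname{rk}(x)$, $A(\mathcal P)=\{a:\operatorname{rk}(a)=1\}$ (the atoms), and $\chi_{\mathcal P}(t)=\sum_{x\in\mathcal P}\mu(\hat 0,x)\,t^{\operatorname{rk}(\mathcal P)-\operatorname{rk}(x)}$, where $\mu$ is the Möbius function. The joins (meets) of a subset are its minimal upper (maximal lower) bounds; a lattice is a poset in which every two elements have exactly one join and exactly one meet. A lattice $L$ is geometric if for all $x,y\in L$: $y$ covers $x$ if and only if $y=x\vee a$ for some atom $a\not\le x$. A poset $\mathcal P$ is locally geometric if $\mathcal P_{\le x}$ is a geometric lattice for every $x\in\mathcal P$. For an atom $a$ let $\mathcal P''=\mathcal P_{\ge a}$, and let $\mathcal P'$ be the subposet of $\mathcal P$ consisting of $\hat 0$ and all joins of subsets of $A(\mathcal P)\setminus\{a\}$. The class $\mathbf{IP}$ of *inductive posets* is the smallest class of locally geometric posets that contains the one-element posets and contains $\mathcal P$ whenever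 there is an atom $a$ with $\mathcal P''\in\mathbf{IP}$, $\mathcal P'\in\mathbf{IP}$ and $\chi_{\mathcal P''}(t)\mid\chi_{\mathcal P'}(t)$. The class $\mathbf{DP}$ of *divisional posets* is the smallest class of locally geometric posets that contains the one-element posets and contains $\mathcal P$ whenever there is an atom $a$ with $\mathcal P''\in\mathbf{DP}$ and $\chi_{\mathcal P''}(t)\mid\chi_{\mathcal P}(t)$. **Arrangements.** Let $G\simeq(\mathbb S^1)^a\times\mathbb R^b$ with $a,b\ge 0$, let $g=\dim_{\mathbb R}G=a+b$, let $\Gamma\simeq\mathbb Z^\ell$ with $\ell\ge0$, and let $T=\operatorname{Hom}(\Gamma,G)\simeq G^\ell$. For $\alpha\in\Gamma\setminus\{0\}$ and $c\in G$ let $H_{\alpha,c}=\{\varphi\in T:\varphi(\alpha)=c\}$. An *abelian arrangement* in $T$ is the set $\mathscr A$ of all connected components of the $H_{\alpha,c}$, $(\alpha,c)\in\mathcal A$, for some finite set $\mathcal A\subseteq(\Gamma\setminus\{0\})\times G$. Its *poset of layers* $L(\mathscr A)$ consists of all connected components of nonempty intersections of members of $\mathscr A$ (the empty intersection being $T$),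 ordered by reverse inclusion, and $\chi_{\mathscr A}(t)=\sum_{X\in L(\mathscr A)}\mu(T,X)\,t^{\dim_{\mathbb R}X}$. For $H\in\mathscr A$ let $\mathscr A'=\mathscr A\setminus\{H\}$, and let $\mathscr A''$ be the set of connected components of the nonempty sets $K\cap H$, $K\in\mathscr A\setminus\{H\}$; it is an abelian arrangement in $H\simeq G^{\ell-1}$. The class $\mathbf{IA}$ of *inductive arrangements* is the smallest class of abelian arrangements that contains the empty arrangement in $G^m$ for every $m\ge 0$ and contains $\mathscr A$ whenever there is $H\in\mathscr A$ with $\mathscr A''\in\mathbf{IA}$, $\mathscr A'\in\mathbf{IA}$ and $\chi_{\mathscr A'}(t)=(t^g-d)\,\chi_{\mathscr A''}(t)$ for some $d\in\mathbb Z$. The class $\mathbf{DA}$ of *divisional arrangements* is the smallest class of abelian arrangements that contains the empty arrangement in $G^m$ for every $m\ge 0$ and contains $\mathscr A$ whenever there is $H\in\mathscr A$ with $\mathscr A''\in\mathbf{DA}$ and $\chi_{\mathscr A}(t)=(t^g-d)\,\chi_{\mathscr A''}(t)$ for some $d\in\mathbb Z$. **Theorem.** Let $\mathscr A$ be an abelian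 arrangement in $T$. Then $\mathscr A\in\mathbf{IA}$ if and only if $L(\mathscr A)\in\mathbf{IP}$, and $\mathscr A\in\mathbf{DA}$ if and only if $L(\mathscr A)\in\mathbf{DP}$. Consequently, inductiveness and divisionality are combinatorial properties: if $\mathscr A_1,\mathscr A_2$ are abelian arrangements in $T$ with isomorphic posets of layers, then $\mathscr A_1\in\mathbf{IA}$ if and only if $\mathscr A_2\in\mathbf{IA}$, and $\mathscr A_1\in\mathbf{DA}$ if and only if $\mathscr A_2\in\mathbf{DA}$. -/

import Mathlib

open Polynomial

universe u v w

/-! ## Finite ranked posets -/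

section Posets

/-- The set of minimal upper bounds of `S`. -/
def joins {P : Type u} [PartialOrder P] (S : Set P) : Set P :=
  {b | Minimal (fun c => c ∈ upperBounds S) b}

/-- The set of maximal lower bounds of `S`. -/
def meets {P : Type u} [PartialOrder P] (S : Set P) : Set P :=
  {b | Maximal (fun c => c ∈ lowerBounds S) b}

/-- Finite posets with a unique minimal element `0̂`, which are ranked: for every `x` all maximal
chains among those with greatest element `x` have the same length. (In a finite poset, a unique
minimal element is a least element.) -/
structure IsRankedPoset (P : Type u) [PartialOrder P] : Prop where
  finite : Finite P
  exists_bot : ∃ b : P, IsBot b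
  ranked : ∀ (x : P) (C D : Set P),
    Maximal (fun S : Set P => IsChain (· ≤ ·) S ∧ IsGreatest S x) C →
    Maximal (fun S : Set P => IsChain (· ≤ ·) S ∧ IsGreatest S x) D → C.ncard = D.ncard

/-- The rank of an element: the length of the longest chain with greatest element `x`. In a ranked
poset this is the length of every maximal such chain. -/
noncomputable def rk {P : Type u} [PartialOrder P] (x : P) : ℕ := (Order.height x).toNat

/-- The rank of a (finite) poset. -/
noncomputable def posetRank (P : Type u) [PartialOrder P] : ℕ := sSup (Set.range (rk (P := P)))

/-- The set of atoms, i.e. of elements of rank one. -/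
def atomSet (P : Type u) [PartialOrder P] : Set P := {a | rk a = 1}

/-- The Möbius function of a finite poset (junk value `0` for infinite posets). -/
noncomputable def moebius {P : Type u} [PartialOrder P] (x y : P) : ℤ :=
  open Classical in
  if h : Finite P then
    letI : Fintype P := @Fintype.ofFinite P h
    letI : LocallyFiniteOrder P := Fintype.toLocallyFiniteOrder
    IncidenceAlgebra.mu ℤ x y
  else 0

/-- The value `μ(0̂, x)`, where `0̂` is the least element (junk value `0` if there is none). -/
noncomputable def moebiusBot {P : Type u} [PartialOrder P] (x : P) : ℤ :=
  open Classical in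
  if h : ∃ b : P, IsBot b then moebius h.choose x else 0

/-- The characteristic polynomial `∑ₓ μ(0̂, x) t ^ (rk P - rk x)` of a finite ranked poset. -/
noncomputable def posetCharPoly (P : Type u) [PartialOrder P] : ℤ[X] :=
  ∑ᶠ x : P, C (moebiusBot x) * X ^ (posetRank P - rk x)

/-- Geometric lattices. The condition `y ∈ joins {x, a}` says that `y` is the join of `x`, `a`. -/
structure IsGeometricLattice (L : Type u) [PartialOrder L] : Prop where
  isRankedPoset : IsRankedPoset L
  join : ∀ x y : L, ∃! z, z ∈ joins {x, y}
  meet : ∀ x y : L, ∃! z, z ∈ meets {x, y}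
  covBy_iff : ∀ x y : L, x ⋖ y ↔ ∃ a ∈ atomSet L, ¬ a ≤ x ∧ y ∈ joins {x, a}

/-- Locally geometric posets: all `P_{≤ x}` are geometric lattices. -/
structure IsLocallyGeometric (P : Type u) [PartialOrder P] : Prop where
  isRankedPoset : IsRankedPoset P
  geometric : ∀ x : P, IsGeometricLattice (Set.Iic x)

/-- The subposet `P(B)` generated by a set `B` of atoms: it consists of `0̂` and all possible joins
of elements of `B`. -/
def generated {P : Type u} [PartialOrder P] (B : Set P) : Set P :=
  {x | IsBot x ∨ ∃ S ⊆ B, x ∈ joins S}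

/-- The deletion `P' = P(A ∖ {a})`, where `A` is the set of all atoms. -/
def posetDeletion {P : Type u} [PartialOrder P] (a : P) : Set P := generated (atomSet P \ {a})

/-- The class **IP** of inductive posets: the smallest class of locally geometric posets that
contains the one-element posets, and contains `P` as soon as for some atom `a` it contains
`P'' = P_{≥ a}` and `P' = P(A ∖ {a})`, and `χ_{P''}` divides `χ_{P'}`. -/
inductive IsInductivePoset : (P : Type u) → [PartialOrder P] → Prop
  | trivial (P : Type u) [PartialOrder P] [Nonempty P] [Subsingleton P] : IsInductivePoset P
  | step (P : Type u) [PartialOrder P] (hP : IsLocallyGeometric P) (a : P) (ha : a ∈ atomSet P)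
      (hres : IsInductivePoset (Set.Ici a)) (hdel : IsInductivePoset (posetDeletion a))
      (hdvd : posetCharPoly (Set.Ici a) ∣ posetCharPoly (posetDeletion a)) :
      IsInductivePoset P

/-- The class **DP** of divisional posets: the smallest class of locally geometric posets that
contains the one-element posets, and contains `P` as soon as for some atom `a` it contains
`P'' = P_{≥ a}`, and `χ_{P''}` divides `χ_P`. -/
inductive IsDivisionalPoset : (P : Type u) → [PartialOrder P] → Prop
  | trivial (P : Type u) [PartialOrder P] [Nonempty P] [Subsingleton P] : IsDivisionalPoset P
  | step (P : Type u) [PartialOrder P] (hP : IsLocallyGeometric P) (a : P) (ha : a ∈ atomSet P)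
      (hres : IsDivisionalPoset (Set.Ici a))
      (hdvd : posetCharPoly (Set.Ici a) ∣ posetCharPoly P) :
      IsDivisionalPoset P

end Posets

/-! ## Dimension in abelian Lie groups -/

section LieDimension

/-- The Lie algebra of an abelian (Lie) group: its one-parameter subgroups, i.e. the continuous
homomorphisms `ℝ → T`, with pointwise addition and `(r • γ) s = γ (r * s)`. -/
def LieAlg (T : Type u) [AddCommGroup T] [TopologicalSpace T] [IsTopologicalAddGroup T] : Type u :=
  ℝ →ₜ+ T

variable {T : Type u} [AddCommGroup T] [TopologicalSpace T] [IsTopologicalAddGroup T]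

noncomputable instance : AddCommGroup (LieAlg T) :=
  inferInstanceAs (AddCommGroup (ℝ →ₜ+ T))

/-- The value of a one-parameter subgroup at `s`. -/
def LieAlg.at (γ : LieAlg T) (s : ℝ) : T := (show ℝ →ₜ+ T from γ) s

@[ext] theorem LieAlg.ext {γ δ : LieAlg T} (h : ∀ s, γ.at s = δ.at s) : γ = δ :=
  ContinuousAddMonoidHom.ext h

theorem LieAlg.at_add (γ : LieAlg T) (s t : ℝ) : γ.at (s + t) = γ.at s + γ.at t :=
  map_add (show ℝ →ₜ+ T from γ) s t

theorem LieAlg.at_zero (γ : LieAlg T) : γ.at 0 = 0 := map_zero (show ℝ →ₜ+ T from γ)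

theorem LieAlg.add_at (γ δ : LieAlg T) (s : ℝ) : (γ + δ).at s = γ.at s + δ.at s := rfl

theorem LieAlg.zero_at (s : ℝ) : (0 : LieAlg T).at s = 0 := rfl

noncomputable instance : SMul ℝ (LieAlg T) where
  smul r γ := (show ℝ →ₜ+ T from
    { toFun := fun s => γ.at (r * s)
      map_zero' := by rw [mul_zero, LieAlg.at_zero]
      map_add' := fun s t => by rw [mul_add, LieAlg.at_add]
      continuous_toFun :=
        (show ℝ →ₜ+ T from γ).continuous_toFun.comp (continuous_const.mul continuous_id) })

theorem LieAlg.smul_at (r : ℝ) (γ : LieAlg T) (s : ℝ) : (r • γ).at s = γ.at (r * s) := rfl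

noncomputable instance : Module ℝ (LieAlg T) where
  one_smul γ := by ext s; rw [LieAlg.smul_at, one_mul]
  mul_smul r r' γ := by
    ext s; rw [LieAlg.smul_at, LieAlg.smul_at, LieAlg.smul_at]; congr 1; ring
  smul_zero r := by ext s; rw [LieAlg.smul_at, LieAlg.zero_at, LieAlg.zero_at]
  smul_add r γ δ := by
    ext s; rw [LieAlg.smul_at, LieAlg.add_at, LieAlg.add_at, LieAlg.smul_at, LieAlg.smul_at]
  add_smul r r' γ := by
    ext s
    rw [LieAlg.smul_at, LieAlg.add_at, LieAlg.smul_at, LieAlg.smul_at, add_mul, LieAlg.at_add]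
  zero_smul γ := by ext s; rw [LieAlg.smul_at, zero_mul, LieAlg.at_zero, LieAlg.zero_at]

/-- The real dimension `dim_ℝ T = dim_ℝ Lie(T)`. -/
noncomputable def lieDim (T : Type u) [AddCommGroup T] [TopologicalSpace T]
    [IsTopologicalAddGroup T] : ℕ :=
  Module.finrank ℝ (LieAlg T)

/-- The directions of one-parameter subgroups along which `E` is invariant. If `E` is a coset of a
closed subgroup `K`, this is the Lie algebra of `K`. -/
def tangentSpace (E : Set T) : Submodule ℝ (LieAlg T) where
  carrier := {γ | ∀ x ∈ E, ∀ s : ℝ, x + γ.at s ∈ E}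
  zero_mem' := fun x hx s => by rwa [LieAlg.zero_at, add_zero]
  add_mem' := fun {γ δ} hγ hδ x hx s => by
    rw [LieAlg.add_at, ← add_assoc]; exact hδ _ (hγ x hx s) s
  smul_mem' := fun r γ hγ x hx s => by rw [LieAlg.smul_at]; exact hγ x hx _

/-- The real dimension of a coset `E` of a closed subgroup of an abelian Lie group `T`. -/
noncomputable def layerDim (E : Set T) : ℕ := Module.finrank ℝ (tangentSpace E)

end LieDimension

/-! ## Abelian arrangements -/

section Ambient

/-- The ambient group `T = Hom(Γ, G)`, with pointwise addition and the topology of pointwise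
convergence (so that a basis of `Γ ≅ ℤ^ℓ` identifies it with `G^ℓ`). -/
def Ambient (Γ : Type v) (G : Type w) [AddCommGroup Γ] [AddCommGroup G] : Type (max v w) := Γ →+ G

variable {Γ : Type v} {G : Type w} [AddCommGroup Γ] [AddCommGroup G]

instance : AddCommGroup (Ambient Γ G) := inferInstanceAs (AddCommGroup (Γ →+ G))

instance : FunLike (Ambient Γ G) Γ G := inferInstanceAs (FunLike (Γ →+ G) Γ G)

instance : AddMonoidHomClass (Ambient Γ G) Γ G :=
  inferInstanceAs (AddMonoidHomClass (Γ →+ G) Γ G)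

/-- The forgetful homomorphism `Hom(Γ, G) → (Γ → G)`. -/
def Ambient.coeHom : Ambient Γ G →+ (Γ → G) where
  toFun φ := φ
  map_zero' := rfl
  map_add' _ _ := rfl

instance [TopologicalSpace G] : TopologicalSpace (Ambient Γ G) :=
  TopologicalSpace.induced Ambient.coeHom inferInstance

instance [TopologicalSpace G] [IsTopologicalAddGroup G] : IsTopologicalAddGroup (Ambient Γ G) :=
  topologicalAddGroup_induced Ambient.coeHom

end Ambient

section Arrangements

/-- The set of connected components of a subset `S` of a topological space. -/
def components {T : Type u} [TopologicalSpace T] (S : Set T) : Set (Set T) :=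
  {D | ∃ x ∈ S, D = connectedComponentIn S x}

/-- The set of layers of a collection `𝓐` of subsets of `E`: the connected components of all
(nonempty) intersections of members of `𝓐`, the empty intersection being `E`. -/
def layers {T : Type u} [TopologicalSpace T] (E : Set T) (𝓐 : Set (Set T)) : Set (Set T) :=
  {Y | ∃ 𝓑 ⊆ 𝓐, Y ∈ components (E ∩ ⋂₀ 𝓑)}

/-- The intersection poset `L(𝓐)`: the layers, ordered by reverse inclusion. -/
def LayerPoset {T : Type u} [TopologicalSpace T] (E : Set T) (𝓐 : Set (Set T)) : Type u :=
  {Y : Set T // Y ∈ layers E 𝓐}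

instance {T : Type u} [TopologicalSpace T] (E : Set T) (𝓐 : Set (Set T)) :
    PartialOrder (LayerPoset E 𝓐) :=
  PartialOrder.lift (fun Y => OrderDual.toDual Y.1)
    (fun _ _ h => Subtype.ext (OrderDual.toDual.injective h))

/-- The restriction `𝓐'' = 𝓐^H`, an arrangement in `H`. -/
def arrRestriction {T : Type u} [TopologicalSpace T] (𝓐 : Set (Set T)) (H : Set T) :
    Set (Set T) :=
  {D | ∃ K ∈ 𝓐 \ {H}, D ∈ components (K ∩ H)}

/-- The characteristic polynomial `∑_{Y ∈ L} μ_L(E, Y) t ^ dim_ℝ Y` of an arrangement `𝓐` in `E`;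
the least element of `L` is the ambient space `E`. -/
noncomputable def arrCharPoly {T : Type u} [AddCommGroup T] [TopologicalSpace T]
    [IsTopologicalAddGroup T] (E : Set T) (𝓐 : Set (Set T)) : ℤ[X] :=
  ∑ᶠ Y : LayerPoset E 𝓐, C (moebiusBot Y) * X ^ layerDim Y.1

variable {Γ : Type v} {G : Type w} [AddCommGroup Γ] [AddCommGroup G]

/-- The abelian hyperplane `H_{α,c}`. -/
def abelianHyperplane (α : Γ) (c : G) : Set (Ambient Γ G) := {φ | φ α = c}

/-- The abelian arrangement in `T = Hom(Γ, G)` defined by a finite set `𝒜` of pairs `(α, c)`. -/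
def abelianArrangement [TopologicalSpace G] (𝒜 : Finset (Γ × G)) : Set (Set (Ambient Γ G)) :=
  {D | ∃ p ∈ 𝒜, D ∈ components (abelianHyperplane p.1 p.2)}

/-- `𝓐` is an abelian arrangement in the subspace `E ⊆ T`, where `E` is a translate
`{φ₀ + ψ ∘ π | ψ ∈ Hom(Γ/Λ, G)}` of the group `Hom(Γ/Λ, G)`, for a subgroup `Λ` of `Γ` with `Γ/Λ`
torsion-free (so `Γ/Λ ≅ ℤ^m` and `E ≅ G^m`, with `m = 0` allowed). Under this identification the
abelian hyperplanes of `E` are the sets `E ∩ H_{α,c}` with `α ∉ Λ`. The case `Λ = 0` gives the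
abelian arrangements in `T` itself. -/
def IsAbelianArrangementIn [TopologicalSpace G] (E : Set (Ambient Γ G))
    (𝓐 : Set (Set (Ambient Γ G))) : Prop :=
  ∃ (Λ : AddSubgroup Γ) (φ₀ : Ambient Γ G) (𝒜 : Finset (Γ × G)),
    (∀ (n : ℤ) (γ : Γ), n ≠ 0 → n • γ ∈ Λ → γ ∈ Λ) ∧
    E = {φ | ∀ γ ∈ Λ, φ γ = φ₀ γ} ∧
    (∀ p ∈ 𝒜, p.1 ∉ Λ) ∧
    𝓐 = {D | ∃ p ∈ 𝒜, D ∈ components (E ∩ abelianHyperplane p.1 p.2)}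

variable [TopologicalSpace G] [IsTopologicalAddGroup G]

/-- The class **IA** of inductive abelian arrangements (`IsInductiveArrangement E 𝓐`: the
arrangement `𝓐` in the ambient space `E` is inductive): the smallest class of abelian arrangements
that contains the empty arrangements, and contains `𝓐` as soon as for some `H ∈ 𝓐` it contains
`𝓐''` and `𝓐' = 𝓐 ∖ {H}`, and `χ_{𝓐'}(t) = (t ^ g - d) χ_{𝓐''}(t)` for some integer `d`, where
`g = dim_ℝ G`. -/
inductive IsInductiveArrangement : Set (Ambient Γ G) → Set (Set (Ambient Γ G)) → Prop
  | empty (E : Set (Ambient Γ G)) (hE : IsAbelianArrangementIn E ∅) : IsInductiveArrangement E ∅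
  | step (E : Set (Ambient Γ G)) (𝓐 : Set (Set (Ambient Γ G))) (h𝓐 : IsAbelianArrangementIn E 𝓐)
      (H : Set (Ambient Γ G)) (hH : H ∈ 𝓐)
      (hres : IsInductiveArrangement H (arrRestriction 𝓐 H))
      (hdel : IsInductiveArrangement E (𝓐 \ {H})) (d : ℤ)
      (hχ : arrCharPoly E (𝓐 \ {H}) =
        (X ^ lieDim G - C d) * arrCharPoly H (arrRestriction 𝓐 H)) :
      IsInductiveArrangement E 𝓐

/-- The class **DA** of divisional abelian arrangements: the smallest class of abelian arrangements
that contains the empty arrangements, and contains `𝓐` as soon as for some `H ∈ 𝓐` it contains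
`𝓐''`, and `χ_𝓐(t) = (t ^ g - d) χ_{𝓐''}(t)` for some integer `d`, where `g = dim_ℝ G`. -/
inductive IsDivisionalArrangement : Set (Ambient Γ G) → Set (Set (Ambient Γ G)) → Prop
  | empty (E : Set (Ambient Γ G)) (hE : IsAbelianArrangementIn E ∅) : IsDivisionalArrangement E ∅
  | step (E : Set (Ambient Γ G)) (𝓐 : Set (Set (Ambient Γ G))) (h𝓐 : IsAbelianArrangementIn E 𝓐)
      (H : Set (Ambient Γ G)) (hH : H ∈ 𝓐)
      (hres : IsDivisionalArrangement H (arrRestriction 𝓐 H)) (d : ℤ)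
      (hχ : arrCharPoly E 𝓐 =
        (X ^ lieDim G - C d) * arrCharPoly H (arrRestriction 𝓐 H)) :
      IsDivisionalArrangement E 𝓐

end Arrangements

/-!
The proof compares an abelian arrangement `𝓐` in `E` with its poset of layers `L(𝓐)` step by step:
`L(𝓐'')` is the upper set `L(𝓐)_{≥ H}`, `L(𝓐')` is the deletion of the atom `H`, and the condition
on characteristic polynomials on one side translates into the condition on the other. Once this is
known, both equivalences are inductions along the definitions of the classes, and the
combinatorial invariance is a consequence.

Everything about posets follows from a few properties, collected in `IsGeometricArrangement`:
members are connected, intersecting a layer with a member of `𝓐` not containing it lowers the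
dimension by `g = dim G`, and all minimal layers have the same dimension. They make `L(𝓐)` a
locally geometric poset with `rk Y = (dim E - dim Y) / g` (`IsGeometricArrangement.isGeomRank`), and
they give `χ_𝓐(t) = t ^ D * χ_{L(𝓐)}(t ^ g)`, where `D` is the dimension of the minimal layers
(`IsGeometricArrangement.arrCharPoly_eq`). Restriction to `H` keeps `D`. Deletion of `H` either keeps
`D`, and then a quotient of the monic polynomials involved is `t - d` on the side of posets and
`t ^ g - d` on the side of arrangements; or it raises `D` by `g`, and then divisibility of the
polynomials of the posets means equality. In that case one must exclude a factor `t ^ g - d` with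
`d ≠ 0`; this holds because the constant term of the characteristic polynomial of a locally
geometric poset is nonzero, by Rota's theorem on the signs of the Möbius function
(`IsGeomRank.moebiusBot_sign`), which is deduced from Weisner's theorem.

That abelian arrangements have these properties rests on the description of layers as the sets
`agreeSet M ψ` of all homomorphisms that agree with `ψ` on a saturated subgroup `M` of `Γ`. Such
a set is connected because `Γ / M` is projective, so that its points lie on one-parameter
subgroups (`HasExpCover.exists_oneParameter`); and the components of `agreeSet M ψ` for any `M` are
of this form because `G` has finite `n`-torsion. A component of an abelian hyperplane is again an
abelian hyperplane, defined by a primitive element, so deletions are abelian arrangements. If `G` is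
trivial, all posets of layers are points and all arrangements are inductive and divisional.
-/

/-! ### Geometric rank functions -/

section GeomRank

variable {P : Type u} [PartialOrder P]

/-- `x` is the join of `y` and `a` inside the lower set of `z`. Joins are formed below a given
upper bound `z`, because in a locally geometric poset two elements may have several joins. -/
def IsJoinBelow (y a z x : P) : Prop := IsLeast {u | y ≤ u ∧ a ≤ u ∧ u ≤ z} x

/-- A rank function exhibiting `P` as a locally geometric poset with set of atoms `A`: elements
with a common upper bound have a join below it, joining an atom that is not already below raises
the rank by one, and atoms separate comparable elements. -/
structure IsGeomRank (P : Type u) [PartialOrder P] (A : Set P) (ρ : P → ℕ) : Prop where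
  finite : Finite P
  exists_bot : ∃ b : P, IsBot b
  rank_bot : ∀ b : P, IsBot b → ρ b = 0
  exists_join : ∀ x y z : P, x ≤ z → y ≤ z → ∃ w, IsJoinBelow x y z w
  rank_atom : ∀ a ∈ A, ρ a = 1
  rank_join : ∀ x a z w : P, a ∈ A → ¬ a ≤ x → IsJoinBelow x a z w → ρ w = ρ x + 1
  exists_atom : ∀ x y : P, x < y → ∃ a ∈ A, a ≤ y ∧ ¬ a ≤ x

theorem IsJoinBelow.le_bound {y a z x : P} (h : IsJoinBelow y a z x) : x ≤ z := h.1.2.2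

theorem IsJoinBelow.left_le {y a z x : P} (h : IsJoinBelow y a z x) : y ≤ x := h.1.1

theorem IsJoinBelow.right_le {y a z x : P} (h : IsJoinBelow y a z x) : a ≤ x := h.1.2.1

theorem IsJoinBelow.self {y a z x : P} (h : IsJoinBelow y a z x) : IsJoinBelow y a x x :=
  ⟨⟨h.1.1, h.1.2.1, le_rfl⟩, fun _ hu => h.2 ⟨hu.1, hu.2.1, hu.2.2.trans h.1.2.2⟩⟩

variable {A : Set P} {ρ : P → ℕ}

theorem IsGeomRank.strictMono (h : IsGeomRank P A ρ) : StrictMono ρ := by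
  have := h.finite
  intro x y
  induction x using WellFoundedGT.induction with
  | ind x ih =>
    intro hxy
    obtain ⟨a, ha, hay, hax⟩ := h.exists_atom x y hxy
    obtain ⟨w, hw⟩ := h.exists_join x a y hxy.le hay
    have hr := h.rank_join x a y w ha hax hw
    have hxw : x < w := lt_of_le_of_ne hw.left_le (fun he => hax (he ▸ hw.right_le))
    rcases hw.le_bound.eq_or_lt with rfl | hlt
    · omega
    · have := ih w hxw hlt
      omega

theorem IsGeomRank.exists_join_of_covBy (h : IsGeomRank P A ρ) {x y : P} (hxy : x ⋖ y) :
    ∃ a ∈ A, ¬ a ≤ x ∧ IsJoinBelow x a y y := by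
  obtain ⟨a, ha, hay, hax⟩ := h.exists_atom x y hxy.lt
  obtain ⟨w, hw⟩ := h.exists_join x a y hxy.le hay
  have hxw : x < w := lt_of_le_of_ne hw.left_le (fun he => hax (he ▸ hw.right_le))
  obtain rfl : w = y := hw.le_bound.eq_or_lt.resolve_right (fun hlt => hxy.2 hxw hlt)
  exact ⟨a, ha, hax, hw⟩

theorem IsGeomRank.rank_covBy (h : IsGeomRank P A ρ) {x y : P} (hxy : x ⋖ y) :
    ρ y = ρ x + 1 := by
  obtain ⟨a, ha, hax, hj⟩ := h.exists_join_of_covBy hxy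
  exact h.rank_join x a y y ha hax hj

theorem IsGeomRank.exists_covBy (h : IsGeomRank P A ρ) {x y : P} (hxy : x < y) :
    ∃ z, x ≤ z ∧ z ⋖ y := by
  have := h.finite
  obtain ⟨z, ⟨hz, hzy⟩, hmax⟩ := ({z | x ≤ z ∧ z < y} : Set P).toFinite.exists_maximal
    ⟨x, le_rfl, hxy⟩
  exact ⟨z, hz, hzy, fun w hzw hwy => (hmax ⟨hz.trans hzw.le, hwy⟩ hzw.le).not_gt hzw⟩

theorem IsGeomRank.bot_of_rank_zero (h : IsGeomRank P A ρ) {x : P} (hx : ρ x = 0) : IsBot x := by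
  obtain ⟨b, hb⟩ := h.exists_bot
  rcases (hb x).eq_or_lt with rfl | hlt
  · exact hb
  · have := h.strictMono hlt
    omega

theorem IsGeomRank.height_eq (h : IsGeomRank P A ρ) (x : P) : Order.height x = ρ x := by
  apply le_antisymm
  · have := Order.height_le_height_apply_of_strictMono ρ h.strictMono x
    rwa [Order.height_nat] at this
  · obtain ⟨n, hn⟩ : ∃ n, ρ x = n := ⟨_, rfl⟩
    induction n generalizing x with
    | zero => simp [hn]
    | succ n ih =>
      obtain ⟨b, hb⟩ := h.exists_bot
      have hbx : b < x := lt_of_le_of_ne (hb x) (by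
        rintro rfl
        have := h.rank_bot b hb
        omega)
      obtain ⟨z, -, hz⟩ := h.exists_covBy hbx
      have hr := h.rank_covBy hz
      have h1 := ih z (by omega)
      calc ((ρ x : ℕ) : ℕ∞) = ρ z + 1 := by rw [hr]; push_cast; rfl
        _ ≤ Order.height z + 1 := by gcongr
        _ ≤ Order.height x := Order.height_add_one_le hz.lt

theorem IsGeomRank.rk_eq (h : IsGeomRank P A ρ) (x : P) : rk x = ρ x := by
  rw [rk, h.height_eq]; rfl

theorem IsGeomRank.mem_of_rank_one (h : IsGeomRank P A ρ) {x : P} (hx : ρ x = 1) : x ∈ A := by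
  obtain ⟨b, hb⟩ := h.exists_bot
  have hbx : b < x := lt_of_le_of_ne (hb x) (by
    rintro rfl
    have := h.rank_bot b hb
    omega)
  obtain ⟨a, ha, hax, -⟩ := h.exists_atom b x hbx
  rcases hax.eq_or_lt with rfl | hlt
  · exact ha
  · have := h.strictMono hlt
    have := h.rank_atom a ha
    omega

theorem IsGeomRank.atomSet_eq (h : IsGeomRank P A ρ) : atomSet P = A := by
  ext x
  rw [atomSet, Set.mem_ofPred_eq, h.rk_eq]
  exact ⟨h.mem_of_rank_one, h.rank_atom x⟩

/-- A maximal chain below `x` meets every rank up to `ρ x` exactly once. -/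
theorem IsGeomRank.ncard_maximal_chain (h : IsGeomRank P A ρ) (x : P) (D : Set P)
    (hD : Maximal (fun S : Set P => IsChain (· ≤ ·) S ∧ IsGreatest S x) D) :
    D.ncard = ρ x + 1 := by
  have := h.finite
  obtain ⟨⟨hch, hxD, hub⟩, hmax⟩ := hD
  -- an element below `x` that is comparable with all of `D` belongs to `D`
  have key : ∀ z ≤ x, (∀ c ∈ D, z ≤ c ∨ c ≤ z) → z ∈ D := by
    intro z hz hc
    refine hmax ⟨hch.insert (fun c hcD _ => hc c hcD), Set.mem_insert_of_mem _ hxD, ?_⟩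
      (Set.subset_insert z D) (Set.mem_insert z D)
    rintro u (rfl | hu)
    exacts [hz, hub hu]
  have hinj : Set.InjOn ρ D := by
    intro c hc d hd hcd
    rcases hch.total hc hd with hle | hle
    · exact hle.eq_or_lt.resolve_right (fun hlt => by have := h.strictMono hlt; omega)
    · exact (hle.eq_or_lt.resolve_right (fun hlt => by have := h.strictMono hlt; omega)).symm
  have himg : ρ '' D = Set.Iic (ρ x) := by
    apply Set.Subset.antisymm
    · rintro _ ⟨c, hc, rfl⟩
      exact h.strictMono.monotone (hub hc)
    · intro n hn
      -- the least element of `D` of rank at least `n` has rank exactly `n`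
      obtain ⟨c, ⟨hcD, hcn⟩, hmin⟩ := ({c | c ∈ D ∧ n ≤ ρ c} : Set P).toFinite.exists_minimal
        ⟨x, hxD, hn⟩
      refine ⟨c, hcD, le_antisymm ?_ hcn⟩
      by_contra hlt
      push Not at hlt
      obtain ⟨b, hb⟩ := h.exists_bot
      have hbD : b ∈ D := key b (hb x) (fun c _ => Or.inl (hb c))
      obtain ⟨d, ⟨hdD, hdc⟩, hdmax⟩ := ({d | d ∈ D ∧ d < c} : Set P).toFinite.exists_maximal
        ⟨b, hbD, lt_of_le_of_ne (hb c) (by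
          rintro rfl
          have := h.rank_bot b hb
          omega)⟩
      have hcov : d ⋖ c := by
        refine ⟨hdc, fun z hdz hzc => ?_⟩
        have hzD : z ∈ D := by
          refine key z (hzc.le.trans (hub hcD)) (fun e he => ?_)
          rcases hch.total he hcD with hec | hce
          · rcases hec.eq_or_lt with rfl | hec
            · exact Or.inl hzc.le
            · rcases hch.total he hdD with hed | hde
              · exact Or.inr (hed.trans hdz.le)
              · exact Or.inr ((hdmax ⟨he, hec⟩ hde).trans hdz.le)
          · exact Or.inl (hzc.le.trans hce)
        exact (hdmax ⟨hzD, hzc⟩ hdz.le).not_gt hdz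
      have hr := h.rank_covBy hcov
      exact (hmin ⟨hdD, by omega⟩ hdc.le).not_gt hdc
  rw [← hinj.ncard_image, himg, Set.ncard_eq_toFinset_card']
  simp

theorem IsGeomRank.isRankedPoset (h : IsGeomRank P A ρ) : IsRankedPoset P where
  finite := h.finite
  exists_bot := h.exists_bot
  ranked x C D hC hD := by rw [h.ncard_maximal_chain x C hC, h.ncard_maximal_chain x D hD]

theorem IsGeomRank.iic (h : IsGeomRank P A ρ) (t : P) :
    IsGeomRank (Set.Iic t) (Subtype.val ⁻¹' A) (fun x => ρ x.1) where
  finite := have := h.finite; inferInstance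
  exists_bot := by
    obtain ⟨b, hb⟩ := h.exists_bot
    exact ⟨⟨b, hb t⟩, fun x => hb x.1⟩
  rank_bot b hb := by
    obtain ⟨c, hc⟩ := h.exists_bot
    have hcb : b.1 ≤ c := hb ⟨c, hc t⟩
    exact h.rank_bot b.1 (fun x => hcb.trans (hc x))
  exists_join x y z hxz hyz := by
    obtain ⟨w, hw⟩ := h.exists_join x.1 y.1 z.1 hxz hyz
    exact ⟨⟨w, hw.le_bound.trans z.2⟩, hw.1, fun u hu => hw.2 hu⟩
  rank_atom a ha := h.rank_atom a.1 ha
  rank_join x a z w ha hax hj := h.rank_join x.1 a.1 z.1 w.1 ha hax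
    ⟨hj.1, fun u hu => hj.2 (show (⟨u, hu.2.2.trans z.2⟩ : Set.Iic t) ∈ _ from hu)⟩
  exists_atom x y hxy := by
    obtain ⟨a, ha, hay, hax⟩ := h.exists_atom x.1 y.1 hxy
    exact ⟨⟨a, hay.trans y.2⟩, ha, hay, hax⟩

theorem IsGeomRank.mem_joins_iff {t : P} (ht : IsTop t) (h : IsGeomRank P A ρ) (x y z : P) :
    z ∈ joins {x, y} ↔ IsJoinBelow x y t z := by
  obtain ⟨w, hw⟩ := h.exists_join x y t (ht x) (ht y)
  have hub : ∀ u, u ∈ upperBounds {x, y} ↔ u ∈ {u | x ≤ u ∧ y ≤ u ∧ u ≤ t} := fun u => by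
    simp [upperBounds, ht u]
  simp only [joins, Set.mem_ofPred_eq, hub]
  constructor
  · intro hz
    obtain rfl : w = z := le_antisymm (hw.2 hz.1) (hz.2 hw.1 (hw.2 hz.1))
    exact hw
  · exact fun hz => ⟨hz.1, fun u hu _ => hz.2 hu⟩

theorem IsGeomRank.isGeometricLattice {t : P} (ht : IsTop t) (h : IsGeomRank P A ρ) :
    IsGeometricLattice P where
  isRankedPoset := h.isRankedPoset
  join x y := by
    simp only [h.mem_joins_iff ht]
    obtain ⟨w, hw⟩ := h.exists_join x y t (ht x) (ht y)
    exact ⟨w, hw, fun z hz => hz.unique hw⟩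
  meet x y := by
    have := h.finite
    obtain ⟨b, hb⟩ := h.exists_bot
    obtain ⟨m, hm⟩ := (lowerBounds {x, y}).toFinite.exists_maximal ⟨b, fun z _ => hb z⟩
    refine ⟨m, hm, fun l hl => ?_⟩
    have hl' : Maximal (fun c => c ∈ lowerBounds {x, y}) l := hl
    -- the join of two lower bounds is a lower bound
    obtain ⟨w, hw⟩ := h.exists_join l m t (ht _) (ht _)
    have hwl : w ∈ lowerBounds {x, y} := fun u hu => hw.2 ⟨hl'.1 hu, hm.1 hu, ht u⟩
    exact (le_antisymm hw.left_le (hl'.2 hwl hw.left_le)).trans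
      (le_antisymm (hm.2 hwl hw.right_le) hw.right_le)
  covBy_iff x y := by
    simp only [h.mem_joins_iff ht, h.atomSet_eq]
    constructor
    · intro hxy
      obtain ⟨a, ha, hax, hj⟩ := h.exists_join_of_covBy hxy
      obtain ⟨w, hw⟩ := h.exists_join x a t (ht _) (ht _)
      obtain rfl : y = w := le_antisymm (hj.2 ⟨hw.1.1, hw.1.2.1, hw.2 ⟨hj.1.1, hj.1.2.1, ht _⟩⟩)
        (hw.2 ⟨hj.1.1, hj.1.2.1, ht _⟩)
      exact ⟨a, ha, hax, hw⟩
    · rintro ⟨a, ha, hax, hj⟩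
      have hr := h.rank_join x a t y ha hax hj
      refine ⟨lt_of_le_of_ne hj.left_le (by rintro rfl; omega), fun z hxz hzy => ?_⟩
      have := h.strictMono hxz
      have := h.strictMono hzy
      omega

theorem IsGeomRank.isLocallyGeometric (h : IsGeomRank P A ρ) : IsLocallyGeometric P where
  isRankedPoset := h.isRankedPoset
  geometric x := (h.iic x).isGeometricLattice (t := ⟨x, le_rfl⟩) (fun y => y.2)

theorem IsGeomRank.of_orderIso {Q : Type v} [PartialOrder Q] (h : IsGeomRank P A ρ)
    (e : Q ≃o P) : IsGeomRank Q (e ⁻¹' A) (ρ ∘ e) where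
  finite := have := h.finite; Finite.of_equiv P e.symm.toEquiv
  exists_bot := by
    obtain ⟨b, hb⟩ := h.exists_bot
    exact ⟨e.symm b, fun x => e.symm_apply_le.2 (hb _)⟩
  rank_bot b hb := h.rank_bot _ (fun x => e.le_symm_apply.1 (hb _))
  exists_join x y z hxz hyz := by
    obtain ⟨w, hw⟩ := h.exists_join (e x) (e y) (e z) (e.monotone hxz) (e.monotone hyz)
    refine ⟨e.symm w, ?_, fun u hu => ?_⟩
    · exact ⟨e.le_symm_apply.2 hw.1.1, e.le_symm_apply.2 hw.1.2.1, e.symm_apply_le.2 hw.1.2.2⟩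
    · exact e.symm_apply_le.2
        (hw.2 ⟨e.monotone hu.1, e.monotone hu.2.1, e.monotone hu.2.2⟩)
  rank_atom a ha := h.rank_atom _ ha
  rank_join x a z w ha hax hj := by
    refine h.rank_join (e x) (e a) (e z) (e w) ha (fun hle => hax (e.le_iff_le.1 hle)) ?_
    refine ⟨⟨e.monotone hj.1.1, e.monotone hj.1.2.1, e.monotone hj.1.2.2⟩, fun u hu => ?_⟩
    exact e.le_symm_apply.1
      (hj.2 ⟨e.le_symm_apply.2 hu.1, e.le_symm_apply.2 hu.2.1, e.symm_apply_le.2 hu.2.2⟩)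
  exists_atom x y hxy := by
    obtain ⟨a, ha, hay, hax⟩ := h.exists_atom (e x) (e y) (e.lt_iff_lt.2 hxy)
    exact ⟨e.symm a, by simpa using ha, e.symm_apply_le.2 hay,
      fun hle => hax (e.symm_apply_le.1 hle)⟩

theorem IsGeomRank.rank_le_posetRank (h : IsGeomRank P A ρ) (x : P) : ρ x ≤ posetRank P := by
  have := h.finite
  rw [← h.rk_eq]
  exact le_csSup (Set.finite_range _).bddAbove ⟨x, rfl⟩

theorem IsGeomRank.exists_rank_eq_posetRank (h : IsGeomRank P A ρ) :
    ∃ x, ρ x = posetRank P := by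
  have := h.finite
  obtain ⟨b, -⟩ := h.exists_bot
  obtain ⟨x, hx⟩ := Nat.sSup_mem (s := Set.range (rk (P := P))) ⟨_, b, rfl⟩
    (Set.finite_range _).bddAbove
  exact ⟨x, by rw [← h.rk_eq, hx, posetRank]⟩

end GeomRank

/-! ### The Möbius function and the characteristic polynomial -/

section Moebius

variable {P : Type u} [PartialOrder P]

open Classical in
theorem sum_moebiusBot [Fintype P] {b : P} (hb : IsBot b) (x : P) :
    ∑ y with y ≤ x, moebiusBot y = if x = b then 1 else 0 := by
  have hex : ∃ b : P, IsBot b := ⟨b, hb⟩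
  have hbe : hex.choose = b := le_antisymm (hex.choose_spec b) (hb _)
  have hfin : Finite P := inferInstance
  simp only [moebiusBot, dif_pos hex, moebius, dif_pos hfin, hbe]
  let : Fintype P := @Fintype.ofFinite P hfin
  let : LocallyFiniteOrder P := Fintype.toLocallyFiniteOrder
  have := IncidenceAlgebra.sum_Icc_mu_right (𝕜 := ℤ) b x
  simp only [eq_comm (a := b)] at this
  rw [← this]
  refine Finset.sum_congr ?_ (fun _ _ => ?_)
  · ext y; simp [hb y]
  · congr!

open Classical in
/-- The Möbius function is determined by its sums over principal lower sets. -/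
theorem eq_of_sum_le_eq [Fintype P] {f g : P → ℤ}
    (h : ∀ x, ∑ y with y ≤ x, f y = ∑ y with y ≤ x, g y) : f = g := by
  funext x
  induction x using WellFoundedLT.induction with
  | ind x ih =>
    have hs : (Finset.univ.filter (· ≤ x)) = insert x (Finset.univ.filter (· < x)) := by
      ext y; simp [le_iff_eq_or_lt]
    have := h x
    rw [hs, Finset.sum_insert (by simp), Finset.sum_insert (by simp),
      Finset.sum_congr rfl (fun y hy => ih y (by simpa using hy))] at this
    simpa using this

theorem moebiusBot_orderIso {Q : Type v} [PartialOrder Q] [Finite P] (hP : ∃ b : P, IsBot b)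
    (e : P ≃o Q) (x : P) : moebiusBot (e x) = moebiusBot x := by
  classical
  have := Fintype.ofFinite P
  have : Fintype Q := Fintype.ofEquiv P e.toEquiv
  obtain ⟨b, hb⟩ := hP
  have hb' : IsBot (e b) := fun y => e.le_symm_apply.1 (hb _)
  refine congrFun (eq_of_sum_le_eq (f := fun x => moebiusBot (e x)) (fun x => ?_)) x
  rw [sum_moebiusBot hb]
  have := sum_moebiusBot hb' (e x)
  simp only [e.injective.eq_iff] at this
  rw [← this]
  exact Finset.sum_equiv e.toEquiv (by simp) (by simp)

theorem rk_orderIso {Q : Type v} [PartialOrder Q] (e : P ≃o Q) (x : P) : rk (e x) = rk x := by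
  rw [rk, rk, Order.height_orderIso]

theorem posetRank_orderIso {Q : Type v} [PartialOrder Q] (e : P ≃o Q) :
    posetRank P = posetRank Q := by
  rw [posetRank, posetRank, ← e.surjective.range_comp]
  congr 2
  funext x
  exact (rk_orderIso e x).symm

theorem posetCharPoly_orderIso {Q : Type v} [PartialOrder Q] [Finite P]
    (hP : ∃ b : P, IsBot b) (e : P ≃o Q) : posetCharPoly P = posetCharPoly Q := by
  rw [posetCharPoly, posetCharPoly, ← finsum_comp_equiv e.toEquiv]
  refine finsum_congr (fun x => ?_)
  simp [rk_orderIso, posetRank_orderIso e, moebiusBot_orderIso hP]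

variable {A : Set P} {ρ : P → ℕ}

open Classical in
/-- **Weisner's theorem**: `∑ μ(0̂, y) = 0`, the sum being over all `y` whose join with the fixed
element `a ≠ 0̂` below `x` is `x`. -/
theorem IsGeomRank.sum_moebiusBot_join [Fintype P] (h : IsGeomRank P A ρ) {a : P}
    (ha : ¬ IsBot a) (x : P) (hax : a ≤ x) :
    ∑ y with IsJoinBelow y a x x, moebiusBot y = 0 := by
  induction x using WellFoundedLT.induction with
  | ind x ih =>
    obtain ⟨b, hb⟩ := h.exists_bot
    have hxb : x ≠ b := by
      rintro rfl
      exact ha (fun y => hax.trans (hb y))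
    have h0 := sum_moebiusBot hb x
    rw [if_neg hxb] at h0
    have hj : ∀ y, ∃ z, y ≤ x → IsJoinBelow y a x z := fun y => by
      by_cases hy : y ≤ x
      · obtain ⟨z, hz⟩ := h.exists_join y a x hy hax
        exact ⟨z, fun _ => hz⟩
      · exact ⟨x, fun hy' => absurd hy' hy⟩
    choose j hj using hj
    rw [← Finset.sum_fiberwise _ j, Finset.sum_eq_single x] at h0
    · rw [← h0]
      refine Finset.sum_congr ?_ (fun _ _ => rfl)
      ext y
      simp only [Finset.mem_filter, Finset.mem_univ, true_and]
      constructor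
      · exact fun hy => ⟨hy.left_le, (hj y hy.left_le).unique hy⟩
      · rintro ⟨hy, he⟩
        have := hj y hy
        rwa [he] at this
    · intro z _ hzx
      by_cases hz : a ≤ z ∧ z ≤ x
      · rw [← ih z (lt_of_le_of_ne hz.2 hzx) hz.1]
        refine Finset.sum_congr ?_ (fun _ _ => rfl)
        ext y
        simp only [Finset.mem_filter, Finset.mem_univ, true_and]
        constructor
        · rintro ⟨hy, rfl⟩
          exact (hj y hy).self
        · intro hy
          have hyx := hy.left_le.trans hz.2
          have hjy := hj y hyx
          have hle : j y ≤ z := hjy.2 ⟨hy.1.1, hy.1.2.1, hz.2⟩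
          exact ⟨hyx, le_antisymm hle (hy.2 ⟨hjy.1.1, hjy.1.2.1, hle⟩)⟩
      · refine Finset.sum_eq_zero (fun y hy => absurd ?_ hz)
        simp only [Finset.mem_filter, Finset.mem_univ, true_and] at hy
        have := hj y hy.1
        rw [hy.2] at this
        exact ⟨this.right_le, this.le_bound⟩
    · simp

/-- Every element `x` above an atom `a` is the join of `a` and an element not above `a`. -/
theorem IsGeomRank.exists_complement (h : IsGeomRank P A ρ) {a x : P} (ha : a ∈ A)
    (hax : a ≤ x) : ∃ y, IsJoinBelow y a x x ∧ ¬ a ≤ y := by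
  have := h.finite
  obtain ⟨b, hb⟩ := h.exists_bot
  have hab : ¬ a ≤ b := fun hle => by
    have := h.rank_bot a (fun y => hle.trans (hb y))
    have := h.rank_atom a ha
    omega
  obtain ⟨y, ⟨hyx, hay⟩, hmax⟩ := ({y | y ≤ x ∧ ¬ a ≤ y} : Set P).toFinite.exists_maximal
    ⟨b, hb x, hab⟩
  obtain ⟨w, hw⟩ := h.exists_join y a x hyx hax
  refine ⟨y, ?_, hay⟩
  rcases hw.le_bound.eq_or_lt with rfl | hlt
  · exact hw
  · exfalso
    obtain ⟨c, hc, hcx, hcw⟩ := h.exists_atom w x hlt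
    have hcy : ¬ c ≤ y := fun hle => hcw (hle.trans hw.left_le)
    obtain ⟨v, hv⟩ := h.exists_join y c x hyx hcx
    have hav : a ≤ v := by
      by_contra hav
      exact hcy (hv.right_le.trans (hmax ⟨hv.le_bound, hav⟩ hv.left_le))
    have hwv : w ≤ v := hw.2 ⟨hv.left_le, hav, hv.le_bound⟩
    have h1 := h.rank_join y a x w ha hay hw
    have h2 := h.rank_join y c x v hc hcy hv
    rcases hwv.eq_or_lt with rfl | hlt'
    · exact hcw hv.right_le
    · have := h.strictMono hlt'
      omega

/-- **Rota's sign theorem**: `μ(0̂, x)` is nonzero of sign `(-1) ^ rk x`. -/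
theorem IsGeomRank.moebiusBot_sign (h : IsGeomRank P A ρ) (x : P) :
    0 < (-1) ^ ρ x * moebiusBot x := by
  classical
  have := h.finite
  have := Fintype.ofFinite P
  obtain ⟨b, hb⟩ := h.exists_bot
  induction x using WellFoundedLT.induction with
  | ind x ih =>
    rcases (hb x).eq_or_lt with rfl | hbx
    · have := sum_moebiusBot hb b
      rw [if_pos rfl, Finset.sum_eq_single b] at this
      · simp [this, h.rank_bot b hb]
      · intro y hy hyb
        exact absurd (le_antisymm (by simpa using hy) (hb y)) hyb
      · simp
    · obtain ⟨a, ha, hax, hab⟩ := h.exists_atom b x hbx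
      have hs := h.sum_moebiusBot_join (a := a) (fun hbot => hab (hbot b)) x hax
      have hmem : x ∈ Finset.univ.filter (fun y => IsJoinBelow y a x x) := by
        simp only [Finset.mem_filter, Finset.mem_univ, true_and]
        exact ⟨⟨le_rfl, hax, le_rfl⟩, fun u hu => hu.1⟩
      rw [← Finset.add_sum_erase _ _ hmem] at hs
      have hx : moebiusBot x = -∑ y ∈ (Finset.univ.filter
        (fun y => IsJoinBelow y a x x)).erase x, moebiusBot y := by linarith
      rw [hx, mul_neg, ← neg_mul, Finset.mul_sum]
      apply Finset.sum_pos
      · intro y hy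
        simp only [Finset.mem_erase, Finset.mem_filter, Finset.mem_univ, true_and] at hy
        have hay : ¬ a ≤ y := fun hle => hy.1 (le_antisymm hy.2.left_le
          (hy.2.2 ⟨le_rfl, hle, hy.2.left_le⟩))
        rw [h.rank_join y a x x ha hay hy.2, pow_succ]
        simpa using ih y (lt_of_le_of_ne hy.2.left_le hy.1)
      · obtain ⟨y, hy, hay⟩ := h.exists_complement ha hax
        refine ⟨y, ?_⟩
        simp only [Finset.mem_erase, Finset.mem_filter, Finset.mem_univ, true_and]
        exact ⟨fun he => hay (he ▸ hax), hy⟩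

theorem IsGeomRank.posetCharPoly_eq [Fintype P] (h : IsGeomRank P A ρ) :
    posetCharPoly P = ∑ x : P, C (moebiusBot x) * X ^ (posetRank P - ρ x) := by
  rw [posetCharPoly, finsum_eq_sum_of_fintype]
  simp only [h.rk_eq]

/-- The constant term is a sum of values `μ(0̂, x)` with `x` of maximal rank, all of one sign. -/
theorem IsGeomRank.posetCharPoly_coeff_zero (h : IsGeomRank P A ρ) :
    (posetCharPoly P).coeff 0 ≠ 0 := by
  classical
  have := h.finite
  have := Fintype.ofFinite P
  intro h0
  rw [h.posetCharPoly_eq, finsetSum_coeff] at h0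
  have hpos : 0 < ∑ x : P, (-1) ^ posetRank P *
      (C (moebiusBot x) * X ^ (posetRank P - ρ x) : ℤ[X]).coeff 0 := by
    have key : ∀ x : P, ρ x = posetRank P → 0 < (-1) ^ posetRank P *
        (C (moebiusBot x) * X ^ (posetRank P - ρ x) : ℤ[X]).coeff 0 := fun x hx => by
      have := h.moebiusBot_sign x
      rw [hx] at this
      simpa [hx] using this
    apply Finset.sum_pos'
    · intro x _
      rcases (h.rank_le_posetRank x).eq_or_lt with hx | hx
      · exact (key x hx).le
      · rw [coeff_C_mul, coeff_X_pow, if_neg (by omega)]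
        simp
    · obtain ⟨x, hx⟩ := h.exists_rank_eq_posetRank
      exact ⟨x, Finset.mem_univ x, key x hx⟩
  rw [← Finset.mul_sum, h0] at hpos
  simp at hpos

theorem IsGeomRank.posetCharPoly_monic (h : IsGeomRank P A ρ) :
    (posetCharPoly P).Monic ∧ (posetCharPoly P).natDegree = posetRank P := by
  classical
  have := h.finite
  have := Fintype.ofFinite P
  obtain ⟨b, hb⟩ := h.exists_bot
  have hdeg : (posetCharPoly P).natDegree ≤ posetRank P := by
    rw [h.posetCharPoly_eq]
    refine natDegree_sum_le_of_forall_le _ _ (fun x _ => ?_)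
    exact (natDegree_C_mul_X_pow_le _ _).trans (Nat.sub_le _ _)
  have hmu : moebiusBot b = 1 := by
    have := sum_moebiusBot hb b
    rw [if_pos rfl, Finset.sum_eq_single b] at this
    · exact this
    · intro y hy hyb
      exact absurd (le_antisymm (by simpa using hy) (hb y)) hyb
    · simp
  have hcoeff : (posetCharPoly P).coeff (posetRank P) = 1 := by
    rw [h.posetCharPoly_eq, finsetSum_coeff, Finset.sum_eq_single b]
    · simp [hmu, h.rank_bot b hb]
    · intro x _ hxb
      have : ρ x ≠ 0 := fun h0 => hxb (le_antisymm (h.bot_of_rank_zero h0 b) (hb x))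
      have := h.rank_le_posetRank x
      rw [coeff_C_mul, coeff_X_pow, if_neg (by omega), mul_zero]
    · simp
  have hmon := monic_of_natDegree_le_of_coeff_eq_one _ hdeg hcoeff
  refine ⟨hmon, le_antisymm hdeg (le_natDegree_of_ne_zero (by rw [hcoeff]; exact one_ne_zero))⟩

end Moebius

/-! ### Restriction and deletion under isomorphisms -/

section OrderIso

variable {P : Type u} {Q : Type v} [PartialOrder P] [PartialOrder Q]

/-- An isomorphism of posets restricts to an isomorphism of principal upper sets. -/
def iciOrderIso (e : P ≃o Q) (a : P) : Set.Ici a ≃o Set.Ici (e a) where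
  toEquiv := e.toEquiv.subtypeEquiv (fun x => by simp)
  map_rel_iff' {x y} := e.le_iff_le (x := x.1) (y := y.1)

theorem isBot_orderIso (e : P ≃o Q) (x : P) : IsBot (e x) ↔ IsBot x :=
  ⟨fun h y => e.le_iff_le.1 (h (e y)), fun h _ => e.le_symm_apply.1 (h _)⟩

theorem mem_atomSet_orderIso (e : P ≃o Q) (x : P) : e x ∈ atomSet Q ↔ x ∈ atomSet P := by
  simp [atomSet, rk_orderIso]

theorem mem_joins_orderIso (e : P ≃o Q) (S : Set P) (x : P) (hx : x ∈ joins S) :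
    e x ∈ joins (e '' S) := by
  refine ⟨?_, fun y hy hyx => ?_⟩
  · rintro _ ⟨s, hs, rfl⟩
    exact e.monotone (hx.1 hs)
  · have h1 : e.symm y ∈ upperBounds S := fun s hs => e.le_symm_apply.2 (hy ⟨s, hs, rfl⟩)
    exact e.le_symm_apply.1 (hx.2 h1 (e.symm_apply_le.2 hyx))

theorem mem_posetDeletion_orderIso (e : P ≃o Q) (a x : P) (hx : x ∈ posetDeletion a) :
    e x ∈ posetDeletion (e a) := by
  rcases hx with hx | ⟨S, hS, hx⟩
  · exact Or.inl ((isBot_orderIso e x).2 hx)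
  · refine Or.inr ⟨e '' S, ?_, mem_joins_orderIso e S x hx⟩
    rintro _ ⟨s, hs, rfl⟩
    exact ⟨(mem_atomSet_orderIso e s).2 (hS hs).1, fun h => (hS hs).2 (e.injective h)⟩

/-- An isomorphism of posets restricts to an isomorphism of deletions. -/
def posetDeletionOrderIso (e : P ≃o Q) (a : P) : posetDeletion a ≃o posetDeletion (e a) where
  toEquiv := e.toEquiv.subtypeEquiv (fun x =>
    ⟨mem_posetDeletion_orderIso e a x, fun hx => by
      simpa using mem_posetDeletion_orderIso e.symm (e a) (e x) hx⟩)
  map_rel_iff' {x y} := e.le_iff_le (x := x.1) (y := y.1)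

end OrderIso

/-! ### Layers of arrangements in a topological space -/

section Layers

variable {T : Type u} [TopologicalSpace T] {E : Set T} {𝓐 : Set (Set T)}

/-- The element of the poset of layers given by a layer. -/
def LayerPoset.mk (Y : Set T) (hY : Y ∈ layers E 𝓐) : LayerPoset E 𝓐 := ⟨Y, hY⟩

theorem LayerPoset.le_iff {Y Z : LayerPoset E 𝓐} : Y ≤ Z ↔ Z.1 ⊆ Y.1 := Iff.rfl

theorem layers_mono {𝓑 : Set (Set T)} (h : 𝓑 ⊆ 𝓐) : layers E 𝓑 ⊆ layers E 𝓐 := by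
  rintro Y ⟨𝓒, h𝓒, hY⟩
  exact ⟨𝓒, h𝓒.trans h, hY⟩

theorem isPreconnected_of_mem_layers {Y : Set T} (hY : Y ∈ layers E 𝓐) : IsPreconnected Y := by
  obtain ⟨𝓑, -, x, -, rfl⟩ := hY
  exact isPreconnected_connectedComponentIn

theorem nonempty_of_mem_layers {Y : Set T} (hY : Y ∈ layers E 𝓐) : Y.Nonempty := by
  obtain ⟨𝓑, -, x, hx, rfl⟩ := hY
  exact ⟨x, mem_connectedComponentIn hx⟩

theorem subset_of_mem_layers {Y : Set T} (hY : Y ∈ layers E 𝓐) : Y ⊆ E := by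
  obtain ⟨𝓑, -, x, hx, rfl⟩ := hY
  exact (connectedComponentIn_subset _ _).trans Set.inter_subset_left

/-- Any point of a layer can serve as its base point. -/
theorem exists_eq_connectedComponentIn {Y : Set T} (hY : Y ∈ layers E 𝓐) {x : T} (hx : x ∈ Y) :
    ∃ 𝓑 ⊆ 𝓐, x ∈ E ∩ ⋂₀ 𝓑 ∧ Y = connectedComponentIn (E ∩ ⋂₀ 𝓑) x := by
  obtain ⟨𝓑, h𝓑, y, hy, rfl⟩ := hY
  exact ⟨𝓑, h𝓑, connectedComponentIn_subset _ _ hx, connectedComponentIn_eq hx⟩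

theorem connectedComponentIn_mem_layers {𝓑 : Set (Set T)} (h𝓑 : 𝓑 ⊆ 𝓐) {x : T}
    (hx : x ∈ E ∩ ⋂₀ 𝓑) : connectedComponentIn (E ∩ ⋂₀ 𝓑) x ∈ layers E 𝓐 :=
  ⟨𝓑, h𝓑, x, hx, rfl⟩

theorem connectedComponentIn_inter_mem_layers {Y Z : Set T} (hY : Y ∈ layers E 𝓐)
    (hZ : Z ∈ layers E 𝓐) {x : T} (hxY : x ∈ Y) (hxZ : x ∈ Z) :
    connectedComponentIn (Y ∩ Z) x ∈ layers E 𝓐 := by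
  obtain ⟨𝓑, h𝓑, hx𝓑, rfl⟩ := exists_eq_connectedComponentIn hY hxY
  obtain ⟨𝓒, h𝓒, hx𝓒, rfl⟩ := exists_eq_connectedComponentIn hZ hxZ
  have hx : x ∈ E ∩ ⋂₀ (𝓑 ∪ 𝓒) := ⟨hx𝓑.1, by
    rw [Set.sInter_union]; exact ⟨hx𝓑.2, hx𝓒.2⟩⟩
  have hsub : E ∩ ⋂₀ (𝓑 ∪ 𝓒) = (E ∩ ⋂₀ 𝓑) ∩ (E ∩ ⋂₀ 𝓒) := by
    rw [Set.sInter_union, Set.inter_inter_distrib_left]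
  convert connectedComponentIn_mem_layers (Set.union_subset h𝓑 h𝓒) hx using 1
  apply Set.Subset.antisymm
  · apply connectedComponentIn_mono
    rw [hsub]
    exact Set.inter_subset_inter (connectedComponentIn_subset _ _)
      (connectedComponentIn_subset _ _)
  · apply isPreconnected_connectedComponentIn.subset_connectedComponentIn
      (mem_connectedComponentIn hx)
    rw [hsub]
    exact Set.subset_inter (connectedComponentIn_mono _ Set.inter_subset_left)
      (connectedComponentIn_mono _ Set.inter_subset_right)

theorem base_mem_layers (hE : IsPreconnected E) (hne : E.Nonempty) : E ∈ layers E 𝓐 := by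
  obtain ⟨x, hx⟩ := hne
  refine ⟨∅, Set.empty_subset _, x, by simpa using hx, ?_⟩
  rw [Set.sInter_empty, Set.inter_univ, hE.connectedComponentIn hx]

theorem mem_layers_of_mem {K : Set T} (hK : K ∈ 𝓐) (hc : IsPreconnected K) (hne : K.Nonempty)
    (hKE : K ⊆ E) : K ∈ layers E 𝓐 := by
  obtain ⟨x, hx⟩ := hne
  refine ⟨{K}, by simpa using hK, x, by simpa using ⟨hKE hx, hx⟩, ?_⟩
  rw [Set.sInter_singleton, Set.inter_eq_right.2 hKE, hc.connectedComponentIn hx]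

/-- The layers of the restriction `𝓐''` are the layers of `𝓐` contained in `H`. -/
theorem mem_layers_arrRestriction_iff {H : Set T} (hH : H ∈ 𝓐) (hHE : H ⊆ E) {Y : Set T} :
    Y ∈ layers H (arrRestriction 𝓐 H) ↔ Y ∈ layers E 𝓐 ∧ Y ⊆ H := by
  constructor
  · intro hY
    refine ⟨?_, subset_of_mem_layers hY⟩
    obtain ⟨x, hx⟩ := nonempty_of_mem_layers hY
    obtain ⟨𝓑, h𝓑, hx𝓑, rfl⟩ := exists_eq_connectedComponentIn hY hx
    have hK : ∀ D : 𝓑, ∃ K ∈ 𝓐, D.1 = connectedComponentIn (K ∩ H) x := by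
      intro ⟨D, hD⟩
      obtain ⟨K, hK, y, hy, rfl⟩ := h𝓑 hD
      exact ⟨K, hK.1, connectedComponentIn_eq (hx𝓑.2 _ hD)⟩
    choose K hK hDK using hK
    have h𝓒 : insert H (Set.range K) ⊆ 𝓐 := by
      rintro _ (rfl | ⟨D, rfl⟩)
      exacts [hH, hK D]
    have hsub : H ∩ ⋂₀ 𝓑 ⊆ E ∩ ⋂₀ (insert H (Set.range K)) := by
      rintro y ⟨hyH, hy⟩
      refine ⟨hHE hyH, ?_⟩
      rintro _ (rfl | ⟨D, rfl⟩)
      · exact hyH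
      · have := hy D.1 D.2
        rw [hDK D] at this
        exact (connectedComponentIn_subset _ _ this).1
    convert connectedComponentIn_mem_layers (E := E) h𝓒 (hsub hx𝓑) using 1
    apply Set.Subset.antisymm
    · exact connectedComponentIn_mono _ hsub
    · have hmem := mem_connectedComponentIn (hsub hx𝓑)
      have hW := connectedComponentIn_subset (E ∩ ⋂₀ (insert H (Set.range K))) x
      have hWH : connectedComponentIn (E ∩ ⋂₀ (insert H (Set.range K))) x ⊆ H :=
        fun y hy => (hW hy).2 _ (Set.mem_insert _ _)
      apply isPreconnected_connectedComponentIn.subset_connectedComponentIn hmem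
      refine Set.subset_inter hWH (Set.subset_sInter (fun D hD => ?_))
      have hDeq : D = _ := hDK ⟨D, hD⟩
      rw [hDeq]
      apply isPreconnected_connectedComponentIn.subset_connectedComponentIn hmem
      exact Set.subset_inter
        (fun y hy => (hW hy).2 _ (Set.mem_insert_of_mem _ ⟨⟨D, hD⟩, rfl⟩)) hWH
  · rintro ⟨hY, hYH⟩
    obtain ⟨x, hx⟩ := nonempty_of_mem_layers hY
    have hc := isPreconnected_of_mem_layers hY
    obtain ⟨𝓑, h𝓑, hx𝓑, hYeq⟩ := exists_eq_connectedComponentIn hY hx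
    have hYs : Y ⊆ E ∩ ⋂₀ 𝓑 := hYeq ▸ connectedComponentIn_subset _ _
    set 𝓒 : Set (Set T) := (fun K => connectedComponentIn (K ∩ H) x) '' (𝓑 \ {H}) with h𝓒
    have hY𝓒 : Y ⊆ H ∩ ⋂₀ 𝓒 := by
      refine Set.subset_inter hYH (Set.subset_sInter ?_)
      rintro _ ⟨K, hK, rfl⟩
      exact hc.subset_connectedComponentIn hx
        (Set.subset_inter (fun y hy => (hYs hy).2 K hK.1) hYH)
    refine ⟨𝓒, ?_, x, hY𝓒 hx, ?_⟩
    · rintro _ ⟨K, hK, rfl⟩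
      exact ⟨K, ⟨h𝓑 hK.1, hK.2⟩, x, ⟨(hYs hx).2 K hK.1, hYH hx⟩, rfl⟩
    · apply Set.Subset.antisymm
      · exact hc.subset_connectedComponentIn hx hY𝓒
      · rw [hYeq]
        apply connectedComponentIn_mono
        rintro y ⟨hyH, hy⟩
        refine ⟨hHE hyH, fun K hK => ?_⟩
        by_cases hKH : K = H
        · rwa [hKH]
        · exact (connectedComponentIn_subset _ _ (hy _ ⟨K, ⟨hK, hKH⟩, rfl⟩)).1

/-- `L(𝓐'')` is the upper set `L(𝓐)_{≥ H}`. -/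
def restrictionOrderIso {H : Set T} (hH : H ∈ 𝓐) (hHE : H ⊆ E) (hHL : H ∈ layers E 𝓐) :
    LayerPoset H (arrRestriction 𝓐 H) ≃o Set.Ici (LayerPoset.mk H hHL) where
  toFun Y := ⟨.mk Y.1 ((mem_layers_arrRestriction_iff hH hHE).1 Y.2).1,
    ((mem_layers_arrRestriction_iff hH hHE).1 Y.2).2⟩
  invFun Y := .mk Y.1.1 ((mem_layers_arrRestriction_iff hH hHE).2 ⟨Y.1.2, LayerPoset.le_iff.1 Y.2⟩)
  left_inv _ := rfl
  right_inv _ := rfl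
  map_rel_iff' := Iff.rfl

/-- A layer that differs from a larger layer `Z` lies in a member of `𝓐` not containing `Z`. -/
theorem exists_separating_mem {Y Z : Set T} (hY : Y ∈ layers E 𝓐) (hZ : Z ∈ layers E 𝓐)
    (hYZ : Y ⊆ Z) (hne : Y ≠ Z) : ∃ K ∈ 𝓐, Y ⊆ K ∧ ¬ Z ⊆ K := by
  by_contra! hcon
  obtain ⟨x, hx⟩ := nonempty_of_mem_layers hY
  obtain ⟨𝓑, h𝓑, hx𝓑, hYeq⟩ := exists_eq_connectedComponentIn hY hx
  have hYs : Y ⊆ E ∩ ⋂₀ 𝓑 := hYeq ▸ connectedComponentIn_subset _ _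
  refine hne (hYZ.antisymm ?_)
  rw [hYeq]
  refine (isPreconnected_of_mem_layers hZ).subset_connectedComponentIn (hYZ hx)
    (Set.subset_inter (subset_of_mem_layers hZ) (Set.subset_sInter (fun K hK => ?_)))
  exact hcon K (h𝓑 hK) (fun y hy => (hYs hy).2 K hK)

/-- `M` is a minimal layer (a maximal element of the poset of layers): each member of `𝓐` that
meets `M` contains `M`. -/
def IsMinimalLayer (E : Set T) (𝓐 : Set (Set T)) (M : Set T) : Prop :=
  M ∈ layers E 𝓐 ∧ ∀ K ∈ 𝓐, (M ∩ K).Nonempty → M ⊆ K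

theorem IsMinimalLayer.of_arrRestriction {H M : Set T} (hH : H ∈ 𝓐) (hHE : H ⊆ E)
    (hM : IsMinimalLayer H (arrRestriction 𝓐 H) M) : IsMinimalLayer E 𝓐 M := by
  obtain ⟨hML, hMH⟩ := (mem_layers_arrRestriction_iff hH hHE).1 hM.1
  refine ⟨hML, ?_⟩
  rintro K hK ⟨x, hxM, hxK⟩
  by_cases hKH : K = H
  · rwa [hKH]
  · have hx : x ∈ K ∩ H := ⟨hxK, hMH hxM⟩
    exact (hM.2 _ ⟨K, ⟨hK, hKH⟩, x, hx, rfl⟩ ⟨x, hxM, mem_connectedComponentIn hx⟩).trans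
      ((connectedComponentIn_subset _ _).trans Set.inter_subset_left)

end Layers

/-! ### Arrangements whose poset of layers is locally geometric -/

section GeometricArrangement

variable {T : Type u} [AddCommGroup T] [TopologicalSpace T] [IsTopologicalAddGroup T]

/-- The properties of abelian arrangements that determine the shape of their posets of layers:
intersecting a layer with a member of `𝓐` that does not contain it lowers the dimension by `g`,
and all minimal layers have the same dimension. -/
structure IsGeometricArrangement (g : ℕ) (E : Set T) (𝓐 : Set (Set T)) : Prop where
  pos : 0 < g
  isPreconnected_base : IsPreconnected E
  nonempty_base : E.Nonempty
  finite_layers : (layers E 𝓐).Finite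
  subset_base : ∀ K ∈ 𝓐, K ⊆ E
  isPreconnected : ∀ K ∈ 𝓐, IsPreconnected K
  nonempty : ∀ K ∈ 𝓐, K.Nonempty
  not_base_subset : ∀ K ∈ 𝓐, ¬ E ⊆ K
  dim_inter : ∀ Z ∈ layers E 𝓐, ∀ K ∈ 𝓐, ∀ x ∈ Z ∩ K, ¬ Z ⊆ K →
    layerDim Z = layerDim (connectedComponentIn (Z ∩ K) x) + g
  dim_minimal : ∀ M N, IsMinimalLayer E 𝓐 M → IsMinimalLayer E 𝓐 N → layerDim M = layerDim N

namespace IsGeometricArrangement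

variable {g : ℕ} {E : Set T} {𝓐 : Set (Set T)}

theorem base_mem (h : IsGeometricArrangement g E 𝓐) : E ∈ layers E 𝓐 :=
  base_mem_layers h.isPreconnected_base h.nonempty_base

theorem mem_layers (h : IsGeometricArrangement g E 𝓐) {K : Set T} (hK : K ∈ 𝓐) :
    K ∈ layers E 𝓐 :=
  mem_layers_of_mem hK (h.isPreconnected K hK) (h.nonempty K hK) (h.subset_base K hK)

theorem exists_dim_eq (h : IsGeometricArrangement g E 𝓐) {Y Z : Set T} (hY : Y ∈ layers E 𝓐)
    (hZ : Z ∈ layers E 𝓐) (hYZ : Y ⊆ Z) : ∃ n, layerDim Z = layerDim Y + n * g := by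
  obtain ⟨d, hd⟩ : ∃ d, layerDim Z = d := ⟨_, rfl⟩
  induction d using Nat.strong_induction_on generalizing Z with
  | _ d ih =>
    by_cases hne : Y = Z
    · exact ⟨0, by simp [hne]⟩
    obtain ⟨K, hK, hYK, hZK⟩ := exists_separating_mem hY hZ hYZ hne
    obtain ⟨x, hx⟩ := nonempty_of_mem_layers hY
    have hdim := h.dim_inter Z hZ K hK x ⟨hYZ hx, hYK hx⟩ hZK
    obtain ⟨n, hn⟩ := ih _ (by have := h.pos; omega)
      (connectedComponentIn_inter_mem_layers hZ (h.mem_layers hK) (hYZ hx) (hYK hx))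
      ((isPreconnected_of_mem_layers hY).subset_connectedComponentIn hx
        (Set.subset_inter hYZ hYK)) rfl
    exact ⟨n + 1, by rw [hdim, hn]; ring⟩

/-- The rank of a layer: its codimension in `E`, in units of `g`. -/
noncomputable def rank (g : ℕ) (E : Set T) (𝓐 : Set (Set T)) (Y : LayerPoset E 𝓐) : ℕ :=
  (layerDim E - layerDim Y.1) / g

theorem dim_eq (h : IsGeometricArrangement g E 𝓐) (Y : LayerPoset E 𝓐) :
    layerDim E = layerDim Y.1 + rank g E 𝓐 Y * g := by
  obtain ⟨n, hn⟩ := h.exists_dim_eq Y.2 h.base_mem (subset_of_mem_layers Y.2)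
  rw [rank, hn, Nat.add_sub_cancel_left, Nat.mul_div_cancel _ h.pos]

theorem isGeomRank (h : IsGeometricArrangement g E 𝓐) :
    IsGeomRank (LayerPoset E 𝓐) {K | K.1 ∈ 𝓐} (rank g E 𝓐) where
  finite := h.finite_layers.to_subtype
  exists_bot := ⟨.mk E h.base_mem, fun Y => subset_of_mem_layers Y.2⟩
  rank_bot b hb := by
    have hE : b.1 = E := (subset_of_mem_layers b.2).antisymm (hb (.mk E h.base_mem))
    rw [rank, hE, Nat.sub_self, Nat.zero_div]
  exists_join Y Z X hYX hZX := by
    obtain ⟨x, hx⟩ := nonempty_of_mem_layers X.2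
    refine ⟨.mk _ (connectedComponentIn_inter_mem_layers Y.2 Z.2 (hYX hx) (hZX hx)),
      ⟨?_, ?_, ?_⟩, ?_⟩
    · exact (connectedComponentIn_subset _ _).trans Set.inter_subset_left
    · exact (connectedComponentIn_subset _ _).trans Set.inter_subset_right
    · exact (isPreconnected_of_mem_layers X.2).subset_connectedComponentIn hx
        (Set.subset_inter hYX hZX)
    · intro U hU
      exact (isPreconnected_of_mem_layers U.2).subset_connectedComponentIn (hU.2.2 hx)
        (Set.subset_inter hU.1 hU.2.1)
  rank_atom K hK := by
    obtain ⟨x, hx⟩ := h.nonempty _ hK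
    have hdim := h.dim_inter E h.base_mem K.1 hK x ⟨h.subset_base _ hK hx, hx⟩
      (h.not_base_subset _ hK)
    rw [Set.inter_eq_right.2 (h.subset_base _ hK),
      (h.isPreconnected _ hK).connectedComponentIn hx] at hdim
    rw [rank, hdim, Nat.add_sub_cancel_left, Nat.div_self h.pos]
  rank_join Z K X W hK hKZ hW := by
    obtain ⟨x, hx⟩ := nonempty_of_mem_layers X.2
    have hxZ : x ∈ Z.1 := hW.left_le (hW.le_bound hx)
    have hxK : x ∈ K.1 := hW.right_le (hW.le_bound hx)
    have hWeq : W.1 = connectedComponentIn (Z.1 ∩ K.1) x := by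
      apply Set.Subset.antisymm
      · exact (isPreconnected_of_mem_layers W.2).subset_connectedComponentIn (hW.le_bound hx)
          (Set.subset_inter hW.left_le hW.right_le)
      · exact hW.2 (show LayerPoset.mk _ (connectedComponentIn_inter_mem_layers Z.2 K.2 hxZ hxK) ∈ _ from
          ⟨(connectedComponentIn_subset _ _).trans Set.inter_subset_left,
            (connectedComponentIn_subset _ _).trans Set.inter_subset_right,
            (isPreconnected_of_mem_layers X.2).subset_connectedComponentIn hx
              (Set.subset_inter (hW.le_bound.trans' hW.left_le)
                (hW.le_bound.trans' hW.right_le))⟩)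
    have hdim := h.dim_inter Z.1 Z.2 K.1 hK x ⟨hxZ, hxK⟩ hKZ
    rw [← hWeq] at hdim
    have h1 := h.dim_eq Z
    have h2 := h.dim_eq W
    have h3 : rank g E 𝓐 W * g = (rank g E 𝓐 Z + 1) * g := by
      rw [add_mul, one_mul]; omega
    exact Nat.eq_of_mul_eq_mul_right h.pos h3
  exists_atom Z Y hZY := by
    obtain ⟨K, hK, hYK, hZK⟩ := exists_separating_mem Y.2 Z.2 hZY.le
      (fun he => hZY.ne (Subtype.ext he.symm))
    exact ⟨.mk K (h.mem_layers hK), hK, hYK, hZK⟩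

theorem mem_posetDeletion_iff (h : IsGeometricArrangement g E 𝓐) {H : Set T} (hH : H ∈ 𝓐)
    (Y : LayerPoset E 𝓐) : Y ∈ posetDeletion (LayerPoset.mk H (h.mem_layers hH)) ↔
      Y.1 ∈ layers E (𝓐 \ {H}) := by
  rw [posetDeletion, h.isGeomRank.atomSet_eq]
  have hmono : layers E (𝓐 \ {H}) ⊆ layers E 𝓐 := layers_mono Set.sdiff_subset
  constructor
  · rintro (hbot | ⟨S, hS, hY⟩)
    · have hE : Y.1 = E := (subset_of_mem_layers Y.2).antisymm (hbot (.mk E h.base_mem))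
      rw [hE]
      exact base_mem_layers h.isPreconnected_base h.nonempty_base
    · obtain ⟨x, hx⟩ := nonempty_of_mem_layers Y.2
      have hYs : Y.1 ⊆ E ∩ ⋂₀ (Subtype.val '' S) := by
        refine Set.subset_inter (subset_of_mem_layers Y.2) (Set.subset_sInter ?_)
        rintro _ ⟨K, hK, rfl⟩
        exact hY.1 hK
      have hmem : connectedComponentIn (E ∩ ⋂₀ (Subtype.val '' S)) x ∈ layers E (𝓐 \ {H}) := by
        refine connectedComponentIn_mem_layers ?_ (hYs hx)
        rintro _ ⟨K, hK, rfl⟩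
        exact ⟨(hS hK).1, fun he => (hS hK).2 (Subtype.ext he)⟩
      have hle : Y.1 ⊆ connectedComponentIn (E ∩ ⋂₀ (Subtype.val '' S)) x :=
        (isPreconnected_of_mem_layers Y.2).subset_connectedComponentIn hx hYs
      have hge := hY.2 (y := .mk _ (hmono hmem))
        (fun K hK => (connectedComponentIn_subset _ _).trans
          (Set.inter_subset_right.trans (Set.sInter_subset_of_mem ⟨K, hK, rfl⟩))) hle
      rw [hle.antisymm hge]
      exact hmem
  · intro hY
    obtain ⟨x, hx⟩ := nonempty_of_mem_layers hY
    obtain ⟨𝓑, h𝓑, hx𝓑, hYeq⟩ := exists_eq_connectedComponentIn hY hx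
    have hYs : Y.1 ⊆ E ∩ ⋂₀ 𝓑 := hYeq ▸ connectedComponentIn_subset _ _
    refine Or.inr ⟨{K | K.1 ∈ 𝓑}, fun K hK => ⟨(h𝓑 hK).1, fun he => (h𝓑 hK).2 ?_⟩, ?_, ?_⟩
    · exact congrArg Subtype.val he
    · exact fun K hK y hy => (hYs hy).2 K.1 hK
    · intro Z hZ hZY
      rw [LayerPoset.le_iff, hYeq]
      refine (isPreconnected_of_mem_layers Z.2).subset_connectedComponentIn (hZY hx)
        (Set.subset_inter (subset_of_mem_layers Z.2) (Set.subset_sInter (fun K hK => ?_)))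
      exact hZ (a := .mk K (h.mem_layers (h𝓑 hK).1)) hK

/-- `L(𝓐')` is the deletion `L(𝓐)'`. -/
def deletionOrderIso (h : IsGeometricArrangement g E 𝓐) {H : Set T} (hH : H ∈ 𝓐) :
    LayerPoset E (𝓐 \ {H}) ≃o posetDeletion (LayerPoset.mk H (h.mem_layers hH)) where
  toFun Y := ⟨.mk Y.1 (layers_mono Set.sdiff_subset Y.2), (h.mem_posetDeletion_iff hH _).2 Y.2⟩
  invFun Y := .mk Y.1.1 ((h.mem_posetDeletion_iff hH _).1 Y.2)
  left_inv _ := rfl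
  right_inv _ := rfl
  map_rel_iff' := Iff.rfl

theorem isMinimalLayer_of_rank (h : IsGeometricArrangement g E 𝓐) (Y : LayerPoset E 𝓐)
    (hY : rank g E 𝓐 Y = posetRank (LayerPoset E 𝓐)) : IsMinimalLayer E 𝓐 Y.1 := by
  refine ⟨Y.2, ?_⟩
  rintro K hK ⟨x, hxY, hxK⟩
  by_contra hYK
  have hdim := h.dim_inter Y.1 Y.2 K hK x ⟨hxY, hxK⟩ hYK
  have hmem := connectedComponentIn_inter_mem_layers Y.2 (h.mem_layers hK) hxY hxK
  have h1 := h.dim_eq Y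
  have h2 := h.dim_eq (.mk _ hmem)
  have h3 := Nat.mul_le_mul_right g (h.isGeomRank.rank_le_posetRank (.mk _ hmem))
  rw [← hY] at h3
  have := h.pos
  rw [show (LayerPoset.mk _ hmem).1 = connectedComponentIn (Y.1 ∩ K) x from rfl] at h2
  omega

theorem exists_isMinimalLayer (h : IsGeometricArrangement g E 𝓐) :
    ∃ M, IsMinimalLayer E 𝓐 M := by
  obtain ⟨Y, hY⟩ := h.isGeomRank.exists_rank_eq_posetRank
  exact ⟨Y.1, h.isMinimalLayer_of_rank Y hY⟩

theorem dim_eq_of_isMinimalLayer (h : IsGeometricArrangement g E 𝓐) {M : Set T}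
    (hM : IsMinimalLayer E 𝓐 M) :
    layerDim E = layerDim M + posetRank (LayerPoset E 𝓐) * g := by
  obtain ⟨Y, hY⟩ := h.isGeomRank.exists_rank_eq_posetRank
  rw [h.dim_minimal M Y.1 hM (h.isMinimalLayer_of_rank Y hY), ← hY]
  exact h.dim_eq Y

/-- The characteristic polynomial of an arrangement is that of its poset of layers evaluated at
`t ^ g`, times a power of `t` that records the dimension of the minimal layers. -/
theorem arrCharPoly_eq (h : IsGeometricArrangement g E 𝓐) {M : Set T}
    (hM : IsMinimalLayer E 𝓐 M) :
    arrCharPoly E 𝓐 = X ^ layerDim M * expand ℤ g (posetCharPoly (LayerPoset E 𝓐)) := by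
  classical
  have := h.isGeomRank.finite
  have := Fintype.ofFinite (LayerPoset E 𝓐)
  rw [h.isGeomRank.posetCharPoly_eq, arrCharPoly, finsum_eq_sum_of_fintype, map_sum,
    Finset.mul_sum]
  refine Finset.sum_congr rfl (fun Y _ => ?_)
  have h1 := h.dim_eq Y
  have h2 := h.dim_eq_of_isMinimalLayer hM
  obtain ⟨k, hk⟩ := Nat.exists_eq_add_of_le (h.isGeomRank.rank_le_posetRank Y)
  have h3 : layerDim Y.1 = layerDim M + g * k := by
    rw [hk, add_mul, mul_comm k] at h2
    omega
  rw [hk, Nat.add_sub_cancel_left, map_mul, expand_C, map_pow, expand_X, h3, pow_add, pow_mul]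
  ring

theorem dim_base_of_mem (h : IsGeometricArrangement g E 𝓐) {H : Set T} (hH : H ∈ 𝓐) :
    layerDim E = layerDim H + g := by
  have := h.dim_eq (.mk H (h.mem_layers hH))
  rwa [h.isGeomRank.rank_atom (.mk H _) hH, one_mul] at this

/-- Deleting `H` either keeps the minimal layers of `𝓐`, or raises their dimension by `g`. -/
theorem isMinimalLayer_or_of_deletion (h : IsGeometricArrangement g E 𝓐) {H M : Set T}
    (hH : H ∈ 𝓐) (hM : IsMinimalLayer E (𝓐 \ {H}) M) :
    IsMinimalLayer E 𝓐 M ∨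
      ∃ N, IsMinimalLayer E 𝓐 N ∧ layerDim M = layerDim N + g := by
  have hML : M ∈ layers E 𝓐 := layers_mono Set.sdiff_subset hM.1
  by_cases hMH : (M ∩ H).Nonempty ∧ ¬ M ⊆ H
  · obtain ⟨⟨x, hx⟩, hsub⟩ := hMH
    refine Or.inr ⟨_, ⟨connectedComponentIn_inter_mem_layers hML (h.mem_layers hH) hx.1 hx.2,
      ?_⟩, h.dim_inter M hML H hH x hx hsub⟩
    rintro K hK ⟨y, hy, hyK⟩
    by_cases hKH : K = H
    · rw [hKH]
      exact (connectedComponentIn_subset _ _).trans Set.inter_subset_right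
    · exact ((connectedComponentIn_subset _ _).trans Set.inter_subset_left).trans
        (hM.2 K ⟨hK, hKH⟩ ⟨y, (connectedComponentIn_subset _ _ hy).1, hyK⟩)
  · refine Or.inl ⟨hML, fun K hK hne => ?_⟩
    by_cases hKH : K = H
    · subst hKH
      by_contra hsub
      exact hMH ⟨hne, hsub⟩
    · exact hM.2 K ⟨hK, hKH⟩ hne

end IsGeometricArrangement

end GeometricArrangement

/-! ### One-parameter subgroups of `(S¹)ᵃ × ℝᵇ` -/

section OneParameter

variable {T : Type u} [AddCommGroup T] [TopologicalSpace T] [IsTopologicalAddGroup T]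

/-- The one-parameter subgroup given by a continuous homomorphism `ℝ → T`. -/
def LieAlg.ofMap (f : ℝ → T) (hf : Continuous f) (hadd : ∀ s t, f (s + t) = f s + f t) :
    LieAlg T :=
  (show ℝ →ₜ+ T from
    { toAddMonoidHom := AddMonoidHom.mk' f hadd
      continuous_toFun := hf })

theorem LieAlg.ofMap_at (f : ℝ → T) (hf : Continuous f)
    (hadd : ∀ s t, f (s + t) = f s + f t) (s : ℝ) : (LieAlg.ofMap f hf hadd).at s = f s := rfl

theorem LieAlg.continuous_at (γ : LieAlg T) : Continuous γ.at :=
  (show ℝ →ₜ+ T from γ).continuous_toFun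

/-- Evaluation of one-parameter subgroups at a fixed time. -/
def LieAlg.evalHom (s : ℝ) : LieAlg T →+ T where
  toFun γ := γ.at s
  map_zero' := rfl
  map_add' _ _ := rfl

theorem LieAlg.at_zsmul (γ : LieAlg T) (n : ℤ) (s : ℝ) : γ.at (n * s) = n • γ.at s := by
  have := map_zsmul (AddMonoidHom.mk' γ.at γ.at_add) n s
  simpa using this

theorem LieAlg.zsmul_at (γ : LieAlg T) (n : ℤ) (s : ℝ) : (n • γ).at s = n • γ.at s :=
  map_zsmul (LieAlg.evalHom s) n γ

/-- The properties of `(S¹)ᵃ × ℝᵇ` on which everything else depends. -/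
structure HasExpCover (G : Type u) [AddCommGroup G] [TopologicalSpace G]
    [IsTopologicalAddGroup G] : Prop where
  t1 : T1Space G
  exp_surjective : ∀ x : G, ∃ γ : LieAlg G, γ.at 1 = x
  finiteDimensional : FiniteDimensional ℝ (LieAlg G)
  finite_torsion : ∀ n : ℤ, n ≠ 0 → {x : G | n • x = 0}.Finite

/-- A continuous homomorphism `ℝ → S¹` lifts to `ℝ` through the covering `ℝ → S¹`, and the lift is
linear. -/
theorem exists_eq_coe_mul (f : ℝ → UnitAddCircle) (hf : Continuous f)
    (hadd : ∀ s t, f (s + t) = f s + f t) : ∃ r : ℝ, ∀ s, f s = ((s * r : ℝ) : UnitAddCircle) := by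
  have cov := AddCircle.isCoveringMap_coe (1 : ℝ)
  have hf0 : f 0 = 0 := by simpa using hadd 0 0
  obtain ⟨F, ⟨hF0, hF⟩, -⟩ := cov.existsUnique_continuousMap_lifts ⟨f, hf⟩ (0 : ℝ) (0 : ℝ)
    (by simp [hf0])
  have hFs : ∀ s, ((F s : ℝ) : UnitAddCircle) = f s := fun s => congrFun hF s
  have hFadd : ∀ s t, F (s + t) = F s + F t := by
    intro s t
    refine congrFun (cov.eq_of_comp_eq (g₁ := fun s => F (s + t)) (g₂ := fun s => F s + F t)
      (by fun_prop) (by fun_prop) ?_ 0 (by simp [hF0])) s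
    funext s
    simp only [Function.comp_apply, AddCircle.coe_add]
    rw [hFs, hFs, hFs, hadd]
  refine ⟨F 1, fun s => ?_⟩
  have := map_real_smul (AddMonoidHom.mk' F hFadd) F.continuous s 1
  simp only [AddMonoidHom.mk'_apply, smul_eq_mul, mul_one] at this
  rw [← hFs, this]

theorem hasExpCover_of_equiv {G : Type w} [AddCommGroup G] [TopologicalSpace G]
    [IsTopologicalAddGroup G] (a b : ℕ)
    (e : G ≃ₜ+ (Fin a → UnitAddCircle) × (Fin b → ℝ)) : HasExpCover G := by
  let f : (Fin a → ℝ) × (Fin b → ℝ) → ℝ → G := fun p s =>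
    e.symm (fun i => ((s * p.1 i : ℝ) : UnitAddCircle), fun j => s * p.2 j)
  have hf : ∀ p, Continuous (f p) := fun p => by
    refine (map_continuous e.symm).comp (Continuous.prodMk ?_ ?_)
    · exact continuous_pi (fun i =>
        (AddCircle.continuous_mk' 1).comp (continuous_id.mul continuous_const))
    · exact continuous_pi (fun j => continuous_id.mul continuous_const)
  have hadd : ∀ p s t, f p (s + t) = f p s + f p t := fun p s t => by
    simp only [f]
    rw [← map_add]
    congr 1
    refine Prod.ext (funext fun i => ?_) (funext fun j => ?_)
    · simp [add_mul]
    · simp [add_mul]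
  let Φ : (Fin a → ℝ) × (Fin b → ℝ) →ₗ[ℝ] LieAlg G :=
    { toFun := fun p => LieAlg.ofMap (f p) (hf p) (hadd p)
      map_add' := fun p q => by
        ext s
        rw [LieAlg.add_at, LieAlg.ofMap_at, LieAlg.ofMap_at, LieAlg.ofMap_at]
        simp only [f]
        rw [← map_add]
        congr 1
        refine Prod.ext (funext fun i => ?_) (funext fun j => ?_)
        · simp [mul_add]
        · simp [mul_add]
      map_smul' := fun r p => by
        ext s
        rw [RingHom.id_apply, LieAlg.smul_at, LieAlg.ofMap_at, LieAlg.ofMap_at]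
        simp only [f, Prod.smul_fst, Prod.smul_snd, Pi.smul_apply, smul_eq_mul]
        congr 1
        refine Prod.ext (funext fun i => ?_) (funext fun j => ?_)
        · exact congrArg (fun x : ℝ => (x : UnitAddCircle))
            (by ring : s * (r * p.1 i) = r * s * p.1 i)
        · exact (by ring : s * (r * p.2 j) = r * s * p.2 j) }
  have hΦ : ∀ p s, (Φ p).at s = f p s := fun p s => rfl
  refine ⟨e.toHomeomorph.symm.t1Space, fun x => ?_, ?_, fun n hn => ?_⟩
  · choose r hr using fun i => QuotientAddGroup.mk_surjective ((e x).1 i)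
    refine ⟨Φ (r, (e x).2), ?_⟩
    rw [hΦ]
    simp only [f, one_mul]
    rw [show (fun i => ((r i : ℝ) : UnitAddCircle)) = (e x).1 from funext hr]
    simp
  · have hsurj : Function.Surjective Φ := by
      intro γ
      have hγ : Continuous fun s => e (γ.at s) := (map_continuous e).comp γ.continuous_at
      have h1 : ∀ i, ∃ r : ℝ, ∀ s, (e (γ.at s)).1 i = ((s * r : ℝ) : UnitAddCircle) := fun i =>
        exists_eq_coe_mul (fun s => (e (γ.at s)).1 i)
          ((continuous_apply i).comp (continuous_fst.comp hγ))
          (fun s t => by simp [LieAlg.at_add])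
      choose r hr using h1
      refine ⟨(r, (e (γ.at 1)).2), ?_⟩
      ext s
      rw [hΦ]
      simp only [f]
      rw [ContinuousAddEquiv.symm_apply_eq]
      refine Prod.ext (funext fun i => (hr i s).symm) (funext fun j => ?_)
      have := map_real_smul (AddMonoidHom.mk' (fun s => (e (γ.at s)).2 j)
        (fun s t => by simp [LieAlg.at_add]))
        ((continuous_apply j).comp (continuous_snd.comp hγ)) s 1
      simpa using this.symm
    exact Module.Finite.of_surjective Φ hsurj
  · have hfin1 : {u : UnitAddCircle | n • u = 0}.Finite :=
      AddCircle.finite_torsion_of_isSMulRegular_int 1 n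
        (.of_right_eq_zero_of_smul fun r hr => by simpa [hn] using hr)
    have hfin : ((Set.univ.pi fun _ : Fin a => {u : UnitAddCircle | n • u = 0}) ×ˢ
        ({0} : Set (Fin b → ℝ))).Finite :=
      (Set.Finite.pi fun _ => hfin1).prod (Set.finite_singleton _)
    refine (hfin.preimage (f := e) e.injective.injOn).subset (fun x hx => ?_)
    have h0 : n • e x = 0 := by rw [← map_zsmul, show n • x = 0 from hx, map_zero]
    refine ⟨fun i _ => ?_, ?_⟩
    · exact congrFun (congrArg Prod.fst h0) i
    · have : n • (e x).2 = 0 := congrArg Prod.snd h0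
      exact (smul_eq_zero.1 this).resolve_left hn

variable {G : Type w} [AddCommGroup G] [TopologicalSpace G] [IsTopologicalAddGroup G]

theorem HasExpCover.exists_zsmul_eq (hG : HasExpCover G) {n : ℤ} (hn : n ≠ 0) (x : G) :
    ∃ y, n • y = x := by
  obtain ⟨γ, rfl⟩ := hG.exp_surjective x
  refine ⟨γ.at (n : ℝ)⁻¹, ?_⟩
  rw [← LieAlg.at_zsmul, mul_inv_cancel₀ (by exact_mod_cast hn)]

theorem HasExpCover.lieDim_pos [Nontrivial G] (hG : HasExpCover G) : 0 < lieDim G := by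
  have := hG.finiteDimensional
  obtain ⟨x, hx⟩ := exists_ne (0 : G)
  obtain ⟨γ, rfl⟩ := hG.exp_surjective x
  have : Nontrivial (LieAlg G) := ⟨γ, 0, fun h => hx (by rw [h, LieAlg.zero_at])⟩
  exact Module.finrank_pos

/-- Since `n`-torsion is finite, a connected set whose points have the same multiple by `n ≠ 0` is
a point. -/
theorem HasExpCover.eq_of_isPreconnected (hG : HasExpCover G) {n : ℤ} (hn : n ≠ 0) {S : Set G}
    (hS : IsPreconnected S) {c : G} (hc : ∀ x ∈ S, n • x = c) {x y : G} (hx : x ∈ S)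
    (hy : y ∈ S) : x = y := by
  have := hG.t1
  by_contra hxy
  refine hS.infinite_of_nontrivial ⟨x, hx, y, hy, hxy⟩ ?_
  refine ((hG.finite_torsion n hn).image (fun t => x + t)).subset (fun z hz => ⟨z - x, ?_, by simp⟩)
  change n • (z - x) = 0
  rw [smul_sub, hc z hz, hc x hx, sub_self]

end OneParameter

/-! ### Cosets of connected subgroups of `Hom(Γ, G)` -/

section Saturation

variable {Γ : Type v} [AddCommGroup Γ]

/-- A subgroup `M` is saturated if `Γ / M` is torsion-free. -/
def IsSaturated (M : AddSubgroup Γ) : Prop :=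
  ∀ (n : ℤ) (γ : Γ), n ≠ 0 → n • γ ∈ M → γ ∈ M

/-- The saturation of `M`: all elements with a nonzero multiple in `M`. -/
def saturation (M : AddSubgroup Γ) : AddSubgroup Γ where
  carrier := {γ | ∃ n : ℤ, n ≠ 0 ∧ n • γ ∈ M}
  zero_mem' := ⟨1, one_ne_zero, by simp⟩
  add_mem' := by
    rintro x y ⟨m, hm, hx⟩ ⟨n, hn, hy⟩
    refine ⟨m * n, mul_ne_zero hm hn, ?_⟩
    rw [smul_add, mul_comm, mul_smul, mul_comm, mul_smul]
    exact M.add_mem (M.zsmul_mem hx n) (M.zsmul_mem hy m)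
  neg_mem' := by
    rintro x ⟨m, hm, hx⟩
    exact ⟨m, hm, by simpa using hx⟩

theorem le_saturation (M : AddSubgroup Γ) : M ≤ saturation M :=
  fun γ hγ => ⟨1, one_ne_zero, by simpa using hγ⟩

theorem isSaturated_saturation (M : AddSubgroup Γ) : IsSaturated (saturation M) := by
  rintro n γ hn ⟨m, hm, h⟩
  exact ⟨m * n, mul_ne_zero hm hn, by rwa [mul_smul]⟩

theorem IsSaturated.saturation_le {M N : AddSubgroup Γ} (hN : IsSaturated N) (h : M ≤ N) :
    saturation M ≤ N := by
  rintro γ ⟨n, hn, hγ⟩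
  exact hN n γ hn (h hγ)

theorem mem_sup_zmultiples {M : AddSubgroup Γ} {α γ : Γ} :
    γ ∈ M ⊔ AddSubgroup.zmultiples α ↔ ∃ m ∈ M, ∃ n : ℤ, m + n • α = γ := by
  simp [AddSubgroup.mem_sup, AddSubgroup.mem_zmultiples_iff]

variable [Module.Finite ℤ Γ]

instance (M : AddSubgroup Γ) : Module.Finite ℤ (Γ ⧸ M) :=
  Module.Finite.of_surjective (QuotientAddGroup.mk' M).toIntLinearMap
    (QuotientAddGroup.mk'_surjective M)

theorem IsSaturated.free {M : AddSubgroup Γ} (hM : IsSaturated M) : Module.Free ℤ (Γ ⧸ M) := by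
  have : Module.IsTorsionFree ℤ (Γ ⧸ M) := by
    refine Module.IsTorsionFree.of_smul_eq_zero (fun n x h => ?_)
    obtain ⟨γ, rfl⟩ := QuotientAddGroup.mk_surjective x
    by_cases hn : n = 0
    · exact Or.inl hn
    · refine Or.inr ((QuotientAddGroup.eq_zero_iff γ).2 (hM n γ hn ?_))
      rwa [← QuotientAddGroup.mk_zsmul, QuotientAddGroup.eq_zero_iff] at h
  exact Module.free_of_finite_type_torsion_free'

/-- An element outside a saturated subgroup `M` is detected by a functional vanishing on `M`. -/
theorem IsSaturated.exists_functional {M : AddSubgroup Γ} (hM : IsSaturated M) {α : Γ}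
    (hα : α ∉ M) : ∃ f : Γ →+ ℤ, (∀ m ∈ M, f m = 0) ∧ f α ≠ 0 := by
  have := hM.free
  have hne : (α : Γ ⧸ M) ≠ 0 := fun h => hα ((QuotientAddGroup.eq_zero_iff α).1 h)
  let b := Module.Free.chooseBasis ℤ (Γ ⧸ M)
  obtain ⟨i, hi⟩ : ∃ i, b.repr (α : Γ ⧸ M) i ≠ 0 := by
    by_contra! hcon
    exact hne (b.repr.map_eq_zero_iff.1 (Finsupp.ext hcon))
  refine ⟨(b.coord i).toAddMonoidHom.comp (QuotientAddGroup.mk' M), fun m hm => ?_, hi⟩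
  have h0 : (m : Γ ⧸ M) = 0 := (QuotientAddGroup.eq_zero_iff m).2 hm
  simp [h0]

/-- If `M` is saturated and `α ∉ M` then `saturation (M + ℤα) / M` is infinite cyclic. -/
theorem IsSaturated.exists_primitive {M : AddSubgroup Γ} (hM : IsSaturated M) {α : Γ}
    (hα : α ∉ M) : ∃ β, β ∉ M ∧
      M ⊔ AddSubgroup.zmultiples β = saturation (M ⊔ AddSubgroup.zmultiples α) := by
  obtain ⟨f, hfM, hfα⟩ := hM.exists_functional hα
  set N := saturation (M ⊔ AddSubgroup.zmultiples α) with hN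
  have hMN : M ≤ N := le_sup_left.trans (le_saturation _)
  have hαN : α ∈ N := le_saturation _ (mem_sup_zmultiples.2 ⟨0, M.zero_mem, 1, by simp⟩)
  have hker : ∀ γ ∈ N, f γ = 0 → γ ∈ M := by
    rintro γ ⟨k, hk, hγ⟩ h0
    obtain ⟨m, hm, n, hmn⟩ := mem_sup_zmultiples.1 hγ
    have h1 := congrArg f hmn
    rw [map_add, hfM m hm, map_zsmul, map_zsmul, h0, smul_zero, zero_add, smul_eq_mul] at h1
    rw [(mul_eq_zero.1 h1).resolve_right hfα, zero_smul, add_zero] at hmn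
    exact hM k γ hk (hmn ▸ hm)
  -- a generator of the image of `N` in `ℤ` lifts to the required element
  obtain ⟨d, hd⟩ := Int.subgroup_cyclic (N.map f)
  have hdN : d ∈ N.map f := by rw [hd]; exact AddSubgroup.subset_closure rfl
  obtain ⟨β, hβN, hβ⟩ := hdN
  have hmul : ∀ γ ∈ N, ∃ n : ℤ, f γ = n * f β := by
    intro γ hγ
    have : f γ ∈ N.map f := ⟨γ, hγ, rfl⟩
    rw [hd, AddSubgroup.mem_closure_singleton] at this
    obtain ⟨n, hn⟩ := this
    exact ⟨n, by rw [← hn, hβ, smul_eq_mul]⟩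
  refine ⟨β, fun hβM => ?_, le_antisymm ?_ ?_⟩
  · obtain ⟨n, hn⟩ := hmul α hαN
    rw [hfM β hβM, mul_zero] at hn
    exact hfα hn
  · exact sup_le hMN ((AddSubgroup.zmultiples_le).2 hβN)
  · intro γ hγ
    obtain ⟨n, hn⟩ := hmul γ hγ
    refine mem_sup_zmultiples.2 ⟨γ - n • β, hker _ (N.sub_mem hγ (N.zsmul_mem hβN n)) ?_, n,
      by simp⟩
    rw [map_sub, map_zsmul, hn, smul_eq_mul, sub_self]

end Saturation

section AgreeSet

variable {Γ : Type v} {G : Type w} [AddCommGroup Γ] [AddCommGroup G]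

/-- The homomorphisms that agree with `ψ` on the subgroup `M`. -/
def agreeSet (M : AddSubgroup Γ) (ψ : Ambient Γ G) : Set (Ambient Γ G) :=
  {φ | ∀ γ ∈ M, φ γ = ψ γ}

theorem mem_agreeSet_self (M : AddSubgroup Γ) (ψ : Ambient Γ G) : ψ ∈ agreeSet M ψ :=
  fun _ _ => rfl

theorem agreeSet_mono {M N : AddSubgroup Γ} (h : M ≤ N) (ψ : Ambient Γ G) :
    agreeSet N ψ ⊆ agreeSet M ψ := fun _ hφ γ hγ => hφ γ (h hγ)

theorem agreeSet_eq_of_mem {M : AddSubgroup Γ} {φ ψ : Ambient Γ G} (h : φ ∈ agreeSet M ψ) :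
    agreeSet M ψ = agreeSet M φ := by
  ext χ
  exact ⟨fun hχ γ hγ => (hχ γ hγ).trans (h γ hγ).symm, fun hχ γ hγ => (hχ γ hγ).trans (h γ hγ)⟩

theorem mem_agreeSet_closure {S : Set Γ} {φ ψ : Ambient Γ G} :
    φ ∈ agreeSet (AddSubgroup.closure S) ψ ↔ ∀ γ ∈ S, φ γ = ψ γ := by
  refine ⟨fun h γ hγ => h γ (AddSubgroup.subset_closure hγ), fun h γ hγ => ?_⟩
  induction hγ using AddSubgroup.closure_induction with
  | mem x hx => exact h x hx
  | zero => rw [map_zero, map_zero]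
  | add x y _ _ hx hy => rw [map_add, map_add, hx, hy]
  | neg x _ hx => rw [map_neg, map_neg, hx]

theorem agreeSet_sup_zmultiples (M : AddSubgroup Γ) (α : Γ) (ψ : Ambient Γ G) :
    agreeSet (M ⊔ AddSubgroup.zmultiples α) ψ = agreeSet M ψ ∩ abelianHyperplane α (ψ α) := by
  ext φ
  constructor
  · exact fun h => ⟨fun γ hγ => h γ (AddSubgroup.mem_sup_left hγ),
      h α (AddSubgroup.mem_sup_right (AddSubgroup.mem_zmultiples α))⟩
  · rintro ⟨h1, h2⟩ γ hγ
    obtain ⟨m, hm, n, rfl⟩ := mem_sup_zmultiples.1 hγ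
    have h2' : φ α = ψ α := h2
    rw [map_add, map_add, map_zsmul, map_zsmul, h1 m hm, h2']

theorem agreeSet_inter_abelianHyperplane {M : AddSubgroup Γ} {α : Γ} {c : G}
    {φ ψ : Ambient Γ G} (h : φ ∈ agreeSet M ψ ∩ abelianHyperplane α c) :
    agreeSet M ψ ∩ abelianHyperplane α c = agreeSet (M ⊔ AddSubgroup.zmultiples α) φ := by
  have hc : φ α = c := h.2
  rw [agreeSet_eq_of_mem h.1, agreeSet_sup_zmultiples, hc]

end AgreeSet

section AmbientLie

variable {Γ : Type v} {G : Type w} [AddCommGroup Γ] [AddCommGroup G] [TopologicalSpace G]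

theorem Ambient.continuous_apply (γ : Γ) : Continuous fun φ : Ambient Γ G => φ γ :=
  (_root_.continuous_apply γ).comp continuous_induced_dom

theorem Ambient.continuous_of_apply {X : Type*} [TopologicalSpace X] {f : X → Ambient Γ G}
    (h : ∀ γ, Continuous fun x => f x γ) : Continuous f :=
  continuous_induced_rng.2 (continuous_pi h)

variable [IsTopologicalAddGroup G]

/-- `Lie(Hom(Γ, G))` consists of the homomorphisms `Γ → Lie(G)`: this is the one-parameter
subgroup belonging to such a homomorphism. -/
noncomputable def LieAlg.ofHom (h : Γ →+ LieAlg G) : LieAlg (Ambient Γ G) :=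
  LieAlg.ofMap (fun s => (show Ambient Γ G from (LieAlg.evalHom s).comp h))
    (Ambient.continuous_of_apply fun γ => (h γ).continuous_at)
    (fun s t => DFunLike.ext _ _ fun γ => (h γ).at_add s t)

theorem LieAlg.ofHom_at (h : Γ →+ LieAlg G) (s : ℝ) (γ : Γ) :
    (LieAlg.ofHom h).at s γ = (h γ).at s := rfl

/-- The derivative of the evaluation `Hom(Γ, G) → G` at `α`. -/
noncomputable def LieAlg.evalAt (α : Γ) : LieAlg (Ambient Γ G) →ₗ[ℝ] LieAlg G where
  toFun δ := LieAlg.ofMap (fun s => δ.at s α)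
    ((Ambient.continuous_apply α).comp δ.continuous_at)
    (fun s t => by rw [δ.at_add]; rfl)
  map_add' _ _ := rfl
  map_smul' _ _ := rfl

theorem LieAlg.evalAt_at (α : Γ) (δ : LieAlg (Ambient Γ G)) (s : ℝ) :
    (LieAlg.evalAt α δ).at s = δ.at s α := rfl

theorem LieAlg.evalAt_eq_zero_iff {α : Γ} {δ : LieAlg (Ambient Γ G)} :
    LieAlg.evalAt α δ = 0 ↔ ∀ s, δ.at s α = 0 :=
  ⟨fun h s => by rw [← LieAlg.evalAt_at, h, LieAlg.zero_at], fun h => LieAlg.ext h⟩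

theorem mem_tangentSpace_agreeSet {M : AddSubgroup Γ} {ψ : Ambient Γ G}
    {δ : LieAlg (Ambient Γ G)} :
    δ ∈ tangentSpace (agreeSet M ψ) ↔ ∀ γ ∈ M, LieAlg.evalAt γ δ = 0 := by
  simp only [LieAlg.evalAt_eq_zero_iff]
  constructor
  · intro h γ hγ s
    have : ψ γ + δ.at s γ = ψ γ := h ψ (mem_agreeSet_self M ψ) s γ hγ
    simpa using this
  · intro h φ hφ s γ hγ
    change φ γ + δ.at s γ = ψ γ
    rw [h γ hγ s, add_zero, hφ γ hγ]

theorem layerDim_agreeSet_congr (M : AddSubgroup Γ) (φ ψ : Ambient Γ G) :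
    layerDim (agreeSet M φ) = layerDim (agreeSet M ψ) := by
  have : tangentSpace (agreeSet M φ) = tangentSpace (agreeSet M ψ) := by
    ext δ; rw [mem_tangentSpace_agreeSet, mem_tangentSpace_agreeSet]
  rw [layerDim, layerDim, this]

variable [Module.Finite ℤ Γ]

theorem HasExpCover.finiteDimensional_ambient (hG : HasExpCover G) :
    FiniteDimensional ℝ (LieAlg (Ambient Γ G)) := by
  have := hG.finiteDimensional
  obtain ⟨s, hs⟩ := Module.Finite.fg_top (R := ℤ) (M := Γ)
  have hinj : Function.Injective
      (LinearMap.pi fun γ : s => LieAlg.evalAt (G := G) (γ : Γ)) := by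
    rw [← LinearMap.ker_eq_bot, LinearMap.ker_eq_bot']
    intro δ hδ
    have hs0 : ∀ γ ∈ s, LieAlg.evalAt γ δ = 0 := fun γ hγ => congrFun hδ ⟨γ, hγ⟩
    ext t
    refine DFunLike.ext _ _ fun γ => ?_
    have hγ : γ ∈ Submodule.span ℤ (s : Set Γ) := hs ▸ Submodule.mem_top
    change δ.at t γ = 0
    induction hγ using Submodule.span_induction with
    | mem x hx => exact LieAlg.evalAt_eq_zero_iff.1 (hs0 x hx) t
    | zero => rw [map_zero]
    | add x y _ _ hx hy => rw [map_add, hx, hy, add_zero]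
    | smul n x _ hx => rw [map_zsmul, hx, smul_zero]
  exact Module.Finite.of_injective _ hinj

/-- Homomorphisms vanishing on a saturated subgroup lie on one-parameter subgroups of such
homomorphisms: `Γ / M` is projective, so they lift through the exponential map of `G`. -/
theorem HasExpCover.exists_oneParameter (hG : HasExpCover G) {M : AddSubgroup Γ}
    (hM : IsSaturated M) (φ : Ambient Γ G) (hφ : ∀ γ ∈ M, φ γ = 0) :
    ∃ δ : LieAlg (Ambient Γ G), δ.at 1 = φ ∧ ∀ s, ∀ γ ∈ M, δ.at s γ = 0 := by
  have := hM.free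
  let f : (Γ ⧸ M) →+ G := QuotientAddGroup.lift M (show Γ →+ G from φ) hφ
  obtain ⟨h, hh⟩ := Module.projective_lifting_property
    (LieAlg.evalHom (T := G) 1).toIntLinearMap f.toIntLinearMap hG.exp_surjective
  refine ⟨LieAlg.ofHom (h.toAddMonoidHom.comp (QuotientAddGroup.mk' M)), ?_, ?_⟩
  · refine DFunLike.ext _ _ fun γ => ?_
    exact LinearMap.congr_fun hh (γ : Γ ⧸ M)
  · intro s γ hγ
    rw [LieAlg.ofHom_at]
    have h0 : (γ : Γ ⧸ M) = 0 := (QuotientAddGroup.eq_zero_iff γ).2 hγ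
    change (h (γ : Γ ⧸ M)).at s = 0
    rw [h0, map_zero, LieAlg.zero_at]

theorem HasExpCover.isPreconnected_agreeSet (hG : HasExpCover G) {M : AddSubgroup Γ}
    (hM : IsSaturated M) (ψ : Ambient Γ G) : IsPreconnected (agreeSet M ψ) := by
  refine isPreconnected_of_forall ψ (fun φ hφ => ?_)
  obtain ⟨δ, hδ1, hδ⟩ := hG.exists_oneParameter hM (φ - ψ) (fun γ hγ => by
    change φ γ - ψ γ = 0
    rw [hφ γ hγ, sub_self])
  refine ⟨Set.range fun s => ψ + δ.at s, ?_, ⟨0, by simp [LieAlg.at_zero]⟩,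
    ⟨1, by simp [hδ1]⟩, isPreconnected_range (continuous_const.add δ.continuous_at)⟩
  rintro _ ⟨s, rfl⟩ γ hγ
  change ψ γ + δ.at s γ = ψ γ
  rw [hδ s γ hγ, add_zero]

/-- The connected components of a coset of `Hom(Γ / M, G)` are cosets of `Hom(Γ / M', G)`, where
`M'` is the saturation of `M`. -/
theorem HasExpCover.connectedComponentIn_agreeSet (hG : HasExpCover G) (M : AddSubgroup Γ)
    (ψ : Ambient Γ G) : connectedComponentIn (agreeSet M ψ) ψ = agreeSet (saturation M) ψ := by
  apply Set.Subset.antisymm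
  · rintro φ hφ γ ⟨n, hn, hγ⟩
    refine hG.eq_of_isPreconnected hn (isPreconnected_connectedComponentIn.image _
      (Ambient.continuous_apply γ).continuousOn) (c := n • ψ γ) ?_
      ⟨φ, hφ, rfl⟩ ⟨ψ, mem_connectedComponentIn (mem_agreeSet_self M ψ), rfl⟩
    rintro _ ⟨χ, hχ, rfl⟩
    simp only
    rw [← map_zsmul, ← map_zsmul]
    exact connectedComponentIn_subset _ _ hχ _ hγ
  · exact (hG.isPreconnected_agreeSet (isSaturated_saturation M) ψ).subset_connectedComponentIn
      (mem_agreeSet_self _ ψ) (agreeSet_mono (le_saturation M) ψ)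

theorem HasExpCover.finite_components_agreeSet (hG : HasExpCover G) (M : AddSubgroup Γ)
    (ψ : Ambient Γ G) : (components (agreeSet M ψ)).Finite := by
  obtain ⟨s, hs⟩ : (saturation M).FG :=
    (Submodule.fg_iff_addSubgroup_fg _).1
      (IsNoetherian.noetherian (AddSubgroup.toIntSubmodule (saturation M)))
  have hmem : ∀ γ : s, ∃ n : ℤ, n ≠ 0 ∧ n • (γ : Γ) ∈ M := fun γ => by
    have : (γ : Γ) ∈ saturation M := hs ▸ AddSubgroup.subset_closure γ.2
    exact this
  choose n hn hnM using hmem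
  -- a component is determined by its values on generators, which are determined up to torsion
  have hfin : (Set.univ.pi fun γ : s => {x : G | n γ • x = ψ (n γ • (γ : Γ))}).Finite := by
    refine Set.Finite.pi fun γ => ?_
    refine ((hG.finite_torsion (n γ) (hn γ)).image (fun t => ψ γ + t)).subset
      (fun x hx => ⟨x - ψ γ, ?_, by simp⟩)
    change n γ • (x - ψ γ) = 0
    rw [smul_sub, show n γ • x = _ from hx, map_zsmul, sub_self]
  refine (hfin.image fun r => {φ : Ambient Γ G | ∀ γ : s, φ γ = r γ}).subset ?_
  rintro _ ⟨φ, hφ, rfl⟩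
  refine ⟨fun γ => φ γ, fun γ _ => ?_, ?_⟩
  · change n γ • φ γ = _
    rw [← map_zsmul]
    exact hφ _ (hnM γ)
  · rw [agreeSet_eq_of_mem hφ, hG.connectedComponentIn_agreeSet, ← hs]
    ext χ
    rw [mem_agreeSet_closure]
    simp

theorem HasExpCover.exists_apply_eq (hG : HasExpCover G) {M : AddSubgroup Γ}
    (hM : IsSaturated M) {α : Γ} (hα : α ∉ M) (ψ : Ambient Γ G) (c : G) :
    ∃ φ ∈ agreeSet M ψ, φ α = c := by
  obtain ⟨f, hfM, hfα⟩ := hM.exists_functional hα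
  obtain ⟨y, hy⟩ := hG.exists_zsmul_eq hfα (c - ψ α)
  let χ : Γ →+ G :=
    { toFun := fun γ => f γ • y
      map_zero' := by simp
      map_add' := fun a b => by rw [map_add, add_smul] }
  refine ⟨ψ + (show Ambient Γ G from χ), fun γ hγ => ?_, ?_⟩
  · change ψ γ + f γ • y = ψ γ
    rw [hfM γ hγ, zero_smul, add_zero]
  · change ψ α + f α • y = c
    rw [hy, add_sub_cancel]

theorem HasExpCover.layerDim_agreeSet (hG : HasExpCover G) {M : AddSubgroup Γ}
    (hM : IsSaturated M) {α : Γ} (hα : α ∉ M) (ψ : Ambient Γ G) :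
    layerDim (agreeSet M ψ) =
      layerDim (agreeSet (saturation (M ⊔ AddSubgroup.zmultiples α)) ψ) + lieDim G := by
  have := hG.finiteDimensional_ambient (Γ := Γ)
  obtain ⟨f, hfM, hfα⟩ := hM.exists_functional hα
  set V := tangentSpace (agreeSet M ψ) with hV
  set W := tangentSpace (agreeSet (saturation (M ⊔ AddSubgroup.zmultiples α)) ψ) with hW
  let L : V →ₗ[ℝ] LieAlg G := (LieAlg.evalAt α).comp V.subtype
  have hWV : W ≤ V := fun δ hδ => mem_tangentSpace_agreeSet.2 fun γ hγ =>
    mem_tangentSpace_agreeSet.1 hδ γ (le_saturation _ (AddSubgroup.mem_sup_left hγ))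
  have hker : LinearMap.ker L = W.comap V.subtype := by
    ext ⟨δ, hδ⟩
    rw [hV, mem_tangentSpace_agreeSet] at hδ
    rw [LinearMap.mem_ker, Submodule.mem_comap, hW, Submodule.subtype_apply,
      mem_tangentSpace_agreeSet]
    constructor
    · rintro h γ ⟨n, hn, hγ⟩
      obtain ⟨m, hm, k, hmk⟩ := mem_sup_zmultiples.1 hγ
      have h0 : LieAlg.evalAt α δ = 0 := h
      have h1 : (n : ℝ) • LieAlg.evalAt γ δ = 0 := by
        rw [Int.cast_smul_eq_zsmul]
        ext s
        rw [LieAlg.zsmul_at, LieAlg.evalAt_at, LieAlg.zero_at, ← map_zsmul, ← hmk, map_add,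
          map_zsmul, LieAlg.evalAt_eq_zero_iff.1 (hδ m hm), LieAlg.evalAt_eq_zero_iff.1 h0,
          smul_zero, add_zero]
      exact (smul_eq_zero.1 h1).resolve_left (by exact_mod_cast hn)
    · intro h
      exact h α (le_saturation _ (AddSubgroup.mem_sup_right (AddSubgroup.mem_zmultiples α)))
  have hsurj : LinearMap.range L = ⊤ := by
    rw [LinearMap.range_eq_top]
    intro δ
    let h : Γ →+ LieAlg G :=
      { toFun := fun γ => f γ • ((f α : ℝ)⁻¹ • δ)
        map_zero' := by simp
        map_add' := fun x y => by rw [map_add, add_smul] }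
    refine ⟨⟨LieAlg.ofHom h, mem_tangentSpace_agreeSet.2 fun γ hγ => ?_⟩, ?_⟩
    · ext s
      rw [LieAlg.evalAt_at, LieAlg.ofHom_at]
      simp [h, hfM γ hγ]
    · change LieAlg.evalAt α (LieAlg.ofHom h) = δ
      have h1 : LieAlg.evalAt α (LieAlg.ofHom h) = h α := rfl
      rw [h1]
      change f α • ((f α : ℝ)⁻¹ • δ) = δ
      rw [← Int.cast_smul_eq_zsmul ℝ, smul_smul, mul_inv_cancel₀ (by exact_mod_cast hfα),
        one_smul]
  have hrn := LinearMap.finrank_range_add_finrank_ker L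
  rw [hsurj, finrank_top, hker, (Submodule.comapSubtypeEquivOfLe hWV).finrank_eq] at hrn
  rw [layerDim, layerDim, lieDim, ← hrn, add_comm]

end AmbientLie

/-! ### Abelian arrangements -/

section AbelianArrangement

variable {Γ : Type v} {G : Type w} [AddCommGroup Γ] [AddCommGroup G]
  {Λ : AddSubgroup Γ} {φ₀ : Ambient Γ G} {E : Set (Ambient Γ G)} {𝓐 : Set (Set (Ambient Γ G))}

/-- An arrangement in `E = agreeSet Λ φ₀` each of whose members is an abelian hyperplane
`E ∩ H_{β,c}` of `E` with `Λ + ℤβ` saturated, so that it is connected. Every abelian arrangement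
has this form, see `HasExpCover.isAbelianArrangementIn_iff`. -/
structure IsPrimitiveArrangement (Λ : AddSubgroup Γ) (φ₀ : Ambient Γ G) (E : Set (Ambient Γ G))
    (𝓐 : Set (Set (Ambient Γ G))) : Prop where
  isSaturated : IsSaturated Λ
  base_eq : E = agreeSet Λ φ₀
  finite : 𝓐.Finite
  exists_eq : ∀ K ∈ 𝓐, ∃ (β : Γ) (c : G), β ∉ Λ ∧
    IsSaturated (Λ ⊔ AddSubgroup.zmultiples β) ∧ K = E ∩ abelianHyperplane β c

theorem IsPrimitiveArrangement.mono (h : IsPrimitiveArrangement Λ φ₀ E 𝓐)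
    {𝓑 : Set (Set (Ambient Γ G))} (h𝓑 : 𝓑 ⊆ 𝓐) : IsPrimitiveArrangement Λ φ₀ E 𝓑 :=
  ⟨h.isSaturated, h.base_eq, h.finite.subset h𝓑, fun K hK => h.exists_eq K (h𝓑 hK)⟩

/-- An intersection of members of a primitive arrangement is described by the subgroup generated
by their defining elements. -/
theorem IsPrimitiveArrangement.inter_sInter_eq {β : Set (Ambient Γ G) → Γ}
    {c : Set (Ambient Γ G) → G} (hE : E = agreeSet Λ φ₀)
    (hK : ∀ K ∈ 𝓐, K = E ∩ abelianHyperplane (β K) (c K)) {𝓑 : Set (Set (Ambient Γ G))}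
    (h𝓑 : 𝓑 ⊆ 𝓐) {φ : Ambient Γ G} (hφ : φ ∈ E ∩ ⋂₀ 𝓑) :
    E ∩ ⋂₀ 𝓑 = agreeSet (AddSubgroup.closure (Λ ∪ β '' 𝓑)) φ := by
  have hval : ∀ K ∈ 𝓑, φ (β K) = c K := fun K hKB => by
    have := hφ.2 K hKB
    rw [hK K (h𝓑 hKB)] at this
    exact this.2
  have hφE : φ ∈ agreeSet Λ φ₀ := hE ▸ hφ.1
  ext χ
  rw [mem_agreeSet_closure]
  constructor
  · rintro ⟨hχE, hχ⟩ γ (hγ | ⟨K, hKB, rfl⟩)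
    · rw [hE] at hχE
      exact (hχE γ hγ).trans (hφE γ hγ).symm
    · have := hχ K hKB
      rw [hK K (h𝓑 hKB)] at this
      exact this.2.trans (hval K hKB).symm
  · intro hχ
    have hχE : χ ∈ E := by
      rw [hE, agreeSet_eq_of_mem hφE]
      exact fun γ hγ => hχ γ (Or.inl hγ)
    refine ⟨hχE, fun K hKB => ?_⟩
    rw [hK K (h𝓑 hKB)]
    exact ⟨hχE, (hχ _ (Or.inr ⟨K, hKB, rfl⟩)).trans (hval K hKB)⟩

variable [TopologicalSpace G] [IsTopologicalAddGroup G] [Module.Finite ℤ Γ]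

theorem HasExpCover.finite_components_inter (hG : HasExpCover G) (M : AddSubgroup Γ)
    (ψ : Ambient Γ G) (α : Γ) (c : G) :
    (components (agreeSet M ψ ∩ abelianHyperplane α c)).Finite := by
  rcases (agreeSet M ψ ∩ abelianHyperplane α c).eq_empty_or_nonempty with h | ⟨φ, hφ⟩
  · rw [h]
    refine Set.finite_empty.subset ?_
    rintro _ ⟨x, hx, -⟩
    exact hx
  · rw [agreeSet_inter_abelianHyperplane hφ]
    exact hG.finite_components_agreeSet _ _

/-- A component of an abelian hyperplane is a connected abelian hyperplane. -/
theorem HasExpCover.exists_eq_of_mem_components (hG : HasExpCover G) (hΛ : IsSaturated Λ)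
    {α : Γ} (hα : α ∉ Λ) {ψ : Ambient Γ G} {c : G} {D : Set (Ambient Γ G)}
    (hD : D ∈ components (agreeSet Λ ψ ∩ abelianHyperplane α c)) :
    ∃ (β : Γ) (c' : G), β ∉ Λ ∧ IsSaturated (Λ ⊔ AddSubgroup.zmultiples β) ∧
      D = agreeSet Λ ψ ∩ abelianHyperplane β c' := by
  obtain ⟨φ, hφ, rfl⟩ := hD
  obtain ⟨β, hβ, hsat⟩ := hΛ.exists_primitive hα
  refine ⟨β, φ β, hβ, hsat ▸ isSaturated_saturation _, ?_⟩
  rw [agreeSet_inter_abelianHyperplane hφ, hG.connectedComponentIn_agreeSet, ← hsat,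
    agreeSet_sup_zmultiples, ← agreeSet_eq_of_mem hφ.1]

theorem HasExpCover.components_eq_singleton (hG : HasExpCover G) (hΛ : IsSaturated Λ)
    {β : Γ} (hβ : β ∉ Λ) (hsat : IsSaturated (Λ ⊔ AddSubgroup.zmultiples β)) (ψ : Ambient Γ G)
    (c : G) : components (agreeSet Λ ψ ∩ abelianHyperplane β c) =
      {agreeSet Λ ψ ∩ abelianHyperplane β c} := by
  obtain ⟨φ, hφ, hc⟩ := hG.exists_apply_eq hΛ hβ ψ c
  have hφ' : φ ∈ agreeSet Λ ψ ∩ abelianHyperplane β c := ⟨hφ, hc⟩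
  have hpre : IsPreconnected (agreeSet Λ ψ ∩ abelianHyperplane β c) := by
    rw [agreeSet_inter_abelianHyperplane hφ']
    exact hG.isPreconnected_agreeSet hsat φ
  ext D
  constructor
  · rintro ⟨χ, hχ, rfl⟩
    exact hpre.connectedComponentIn hχ
  · rintro rfl
    exact ⟨φ, hφ', (hpre.connectedComponentIn hφ').symm⟩

theorem HasExpCover.isAbelianArrangementIn_iff (hG : HasExpCover G) :
    IsAbelianArrangementIn E 𝓐 ↔ ∃ Λ φ₀, IsPrimitiveArrangement Λ φ₀ E 𝓐 := by
  constructor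
  · rintro ⟨Λ, φ₀, 𝒜, hΛ, rfl, h𝒜, rfl⟩
    refine ⟨Λ, φ₀, hΛ, rfl, ?_, ?_⟩
    · refine (𝒜.finite_toSet.biUnion fun p _ =>
        hG.finite_components_inter Λ φ₀ p.1 p.2).subset ?_
      rintro D ⟨p, hp, hD⟩
      exact Set.mem_biUnion hp hD
    · rintro D ⟨p, hp, hD⟩
      exact hG.exists_eq_of_mem_components hΛ (h𝒜 p hp) hD
  · rintro ⟨Λ, φ₀, hΛ, rfl, hfin, hex⟩
    choose! β c hβ hsat hK using hex
    refine ⟨Λ, φ₀, (hfin.image fun K => (β K, c K)).toFinset, hΛ, rfl, ?_, ?_⟩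
    · intro p hp
      obtain ⟨K, hKA, rfl⟩ := (Set.Finite.mem_toFinset _).1 hp
      exact hβ K hKA
    · have hcomp : ∀ K ∈ 𝓐, components (agreeSet Λ φ₀ ∩ abelianHyperplane (β K) (c K)) = {K} :=
        fun K hKA => by
          rw [hG.components_eq_singleton hΛ (hβ K hKA) (hsat K hKA), ← hK K hKA]
      ext D
      constructor
      · intro hD
        refine ⟨(β D, c D), (Set.Finite.mem_toFinset _).2 ⟨D, hD, rfl⟩, ?_⟩
        have : D ∈ components (agreeSet Λ φ₀ ∩ abelianHyperplane (β D) (c D)) := by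
          rw [hcomp D hD]; rfl
        exact this
      · rintro ⟨p, hp, hD⟩
        obtain ⟨K, hKA, rfl⟩ := (Set.Finite.mem_toFinset _).1 hp
        have hD' : D ∈ components (agreeSet Λ φ₀ ∩ abelianHyperplane (β K) (c K)) := hD
        rw [hcomp K hKA] at hD'
        rwa [show D = K from hD']

theorem IsPrimitiveArrangement.arrRestriction (hG : HasExpCover G)
    (h : IsPrimitiveArrangement Λ φ₀ E 𝓐) {H : Set (Ambient Γ G)} (hH : H ∈ 𝓐) :
    ∃ Λ' ψ, IsPrimitiveArrangement Λ' ψ H (arrRestriction 𝓐 H) := by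
  obtain ⟨hΛ, rfl, hfin, hex⟩ := h
  obtain ⟨β, c, hβ, hsat, hHeq⟩ := hex H hH
  obtain ⟨ψ, hψ, hc⟩ := hG.exists_apply_eq hΛ hβ φ₀ c
  have hHψ : H = agreeSet (Λ ⊔ AddSubgroup.zmultiples β) ψ := by
    rw [hHeq]; exact agreeSet_inter_abelianHyperplane ⟨hψ, hc⟩
  have hHE : H ⊆ agreeSet Λ φ₀ := hHeq ▸ Set.inter_subset_left
  have hint : ∀ α c', (agreeSet Λ φ₀ ∩ abelianHyperplane α c') ∩ H =
      H ∩ abelianHyperplane α c' := fun α c' => by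
    rw [Set.inter_right_comm, Set.inter_eq_right.2 hHE]
  refine ⟨_, ψ, hsat, hHψ, ?_, ?_⟩
  · refine (hfin.biUnion (t := fun K => components (K ∩ H)) fun K hK => ?_).subset ?_
    · obtain ⟨α, c', -, -, rfl⟩ := hex K hK
      rw [hint, hHψ]
      exact hG.finite_components_inter _ _ _ _
    · rintro D ⟨K, hK, hD⟩
      exact Set.mem_biUnion hK.1 hD
  · rintro D ⟨K, hK, hD⟩
    obtain ⟨α, c', hα, hαsat, hKeq⟩ := hex K hK.1
    rw [hKeq, hint] at hD
    rw [hHψ] at hD ⊢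
    refine hG.exists_eq_of_mem_components hsat (fun hαΛ => hK.2 ?_) hD
    -- if `α ∈ Λ + ℤβ` then `Λ + ℤα = Λ + ℤβ`, so `K` and `H` are equal or disjoint
    obtain ⟨φ, hφ, -⟩ := hD
    have hle : Λ ⊔ AddSubgroup.zmultiples α ≤ Λ ⊔ AddSubgroup.zmultiples β :=
      sup_le le_sup_left (AddSubgroup.zmultiples_le.2 hαΛ)
    have hge : Λ ⊔ AddSubgroup.zmultiples β ≤ Λ ⊔ AddSubgroup.zmultiples α := by
      refine sup_le le_sup_left (AddSubgroup.zmultiples_le.2 ?_)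
      obtain ⟨m, hm, n, hn⟩ := mem_sup_zmultiples.1 hαΛ
      have hn0 : n ≠ 0 := by
        rintro rfl
        exact hα (by rw [← hn, zero_smul, add_zero]; exact hm)
      refine hαsat n β hn0 (mem_sup_zmultiples.2 ⟨-m, Λ.neg_mem hm, 1, ?_⟩)
      rw [← hn]; simp
    have hφK : φ ∈ agreeSet Λ φ₀ ∩ abelianHyperplane α c' :=
      ⟨hHE (hHψ ▸ hφ.1), hφ.2⟩
    rw [Set.mem_singleton_iff, hKeq, hHψ, agreeSet_inter_abelianHyperplane hφK,
      agreeSet_eq_of_mem hφ.1, le_antisymm hle hge]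

theorem IsPrimitiveArrangement.isGeometricArrangement [Nontrivial G] (hG : HasExpCover G)
    (h : IsPrimitiveArrangement Λ φ₀ E 𝓐) : IsGeometricArrangement (lieDim G) E 𝓐 := by
  obtain ⟨hΛ, hE, hfin, hex⟩ := h
  choose! β c hβ hsat hK using hex
  -- a layer through `x` is `agreeSet N x` with `N` the saturation of `Λ + ∑ ℤ β_K`
  have hlayer : ∀ Z ∈ layers E 𝓐, ∀ x ∈ Z, ∃ 𝓑 ⊆ 𝓐,
      Z = agreeSet (saturation (AddSubgroup.closure (Λ ∪ β '' 𝓑))) x := by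
    intro Z hZ x hx
    obtain ⟨𝓑, h𝓑, hx𝓑, rfl⟩ := exists_eq_connectedComponentIn hZ hx
    exact ⟨𝓑, h𝓑, by
      rw [inter_sInter_eq hE hK h𝓑 hx𝓑, hG.connectedComponentIn_agreeSet]⟩
  have hΛle : ∀ 𝓑 : Set (Set (Ambient Γ G)),
      Λ ≤ saturation (AddSubgroup.closure (Λ ∪ β '' 𝓑)) := fun 𝓑 γ hγ =>
    le_saturation _ (AddSubgroup.subset_closure (Or.inl hγ))
  have hKφ : ∀ K ∈ 𝓐, ∀ φ ∈ K, K = agreeSet (Λ ⊔ AddSubgroup.zmultiples (β K)) φ := by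
    intro K hKA φ hφ
    have := hK K hKA
    rw [hE] at this
    rw [this] at hφ
    rw [← agreeSet_inter_abelianHyperplane hφ]
    exact this
  -- evaluation at an element outside `N` is not constant on `agreeSet N x`
  have hnot : ∀ K ∈ 𝓐, ∀ N x, IsSaturated N → β K ∉ N → ¬ agreeSet N x ⊆ K := by
    intro K hKA N x hN hβN hsub
    obtain ⟨y, hy⟩ := exists_ne (c K)
    obtain ⟨φ, hφ, hφy⟩ := hG.exists_apply_eq hN hβN x y
    have := hsub hφ
    rw [hK K hKA] at this
    exact hy (hφy.symm.trans this.2)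
  refine ⟨hG.lieDim_pos, ?_, ?_, ?_, ?_, ?_, ?_, ?_, ?_, ?_⟩
  · rw [hE]; exact hG.isPreconnected_agreeSet hΛ φ₀
  · rw [hE]; exact ⟨φ₀, mem_agreeSet_self _ _⟩
  · refine (hfin.finite_subsets.biUnion (t := fun 𝓑 => components (E ∩ ⋂₀ 𝓑))
      fun 𝓑 h𝓑 => ?_).subset ?_
    · rcases (E ∩ ⋂₀ 𝓑).eq_empty_or_nonempty with h0 | ⟨φ, hφ⟩
      · rw [h0]
        refine Set.finite_empty.subset ?_
        rintro _ ⟨x, hx, -⟩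
        exact hx
      · rw [inter_sInter_eq hE hK h𝓑 hφ]
        exact hG.finite_components_agreeSet _ _
    · rintro Y ⟨𝓑, h𝓑, hY⟩
      exact Set.mem_biUnion (show 𝓑 ∈ {𝓑 | 𝓑 ⊆ 𝓐} from h𝓑) hY
  · intro K hKA
    rw [hK K hKA]
    exact Set.inter_subset_left
  · intro K hKA
    rcases K.eq_empty_or_nonempty with h0 | ⟨φ, hφ⟩
    · rw [h0]; exact isPreconnected_empty
    · rw [hKφ K hKA φ hφ]
      exact hG.isPreconnected_agreeSet (hsat K hKA) φ
  · intro K hKA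
    obtain ⟨φ, hφ, hc⟩ := hG.exists_apply_eq hΛ (hβ K hKA) φ₀ (c K)
    rw [hK K hKA, hE]
    exact ⟨φ, hφ, hc⟩
  · intro K hKA
    rw [hE]
    exact hnot K hKA Λ φ₀ hΛ (hβ K hKA)
  · rintro Z hZ K hKA x ⟨hxZ, hxK⟩ hZK
    obtain ⟨𝓑, h𝓑, hZeq⟩ := hlayer Z hZ x hxZ
    set N := saturation (AddSubgroup.closure (Λ ∪ β '' 𝓑)) with hN
    have hKx := hKφ K hKA x hxK
    have hβN : β K ∉ N := by
      intro hmem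
      refine hZK ?_
      rw [hZeq, hKx]
      exact agreeSet_mono (sup_le (hΛle 𝓑) (AddSubgroup.zmultiples_le.2 hmem)) x
    have hinter : Z ∩ K = agreeSet (N ⊔ AddSubgroup.zmultiples (β K)) x := by
      conv_lhs => rw [hZeq, hKx]
      rw [agreeSet_sup_zmultiples, agreeSet_sup_zmultiples, ← Set.inter_assoc,
        Set.inter_eq_left.2 (agreeSet_mono (hΛle 𝓑) x)]
    rw [hinter, hG.connectedComponentIn_agreeSet, hZeq]
    exact hG.layerDim_agreeSet (isSaturated_saturation _) hβN x
  · have hmin : ∀ M, IsMinimalLayer E 𝓐 M →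
        ∃ x, M = agreeSet (saturation (AddSubgroup.closure (Λ ∪ β '' 𝓐))) x := by
      rintro M ⟨hML, hM⟩
      obtain ⟨x, hx⟩ := nonempty_of_mem_layers hML
      obtain ⟨𝓑, h𝓑, hMeq⟩ := hlayer M hML x hx
      have hβmem : ∀ K ∈ 𝓐, β K ∈ saturation (AddSubgroup.closure (Λ ∪ β '' 𝓑)) := by
        intro K hKA
        by_contra hβN
        obtain ⟨φ, hφ, hφc⟩ := hG.exists_apply_eq (isSaturated_saturation _) hβN x (c K)
        rw [← hMeq] at hφ
        refine hnot K hKA _ x (isSaturated_saturation _) hβN (hMeq ▸ hM K hKA ⟨φ, hφ, ?_⟩)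
        rw [hK K hKA]
        exact ⟨subset_of_mem_layers hML hφ, hφc⟩
      refine ⟨x, hMeq.trans (congrArg (fun N => agreeSet N x) (le_antisymm ?_ ?_))⟩
      · refine (isSaturated_saturation _).saturation_le (le_trans ?_ (le_saturation _))
        exact AddSubgroup.closure_mono (Set.union_subset_union_right _ (Set.image_mono h𝓑))
      · refine (isSaturated_saturation _).saturation_le ((AddSubgroup.closure_le _).2 ?_)
        rintro γ (hγ | ⟨K, hKA, rfl⟩)
        exacts [hΛle 𝓑 hγ, hβmem K hKA]
    intro M N hM hN
    obtain ⟨x, rfl⟩ := hmin M hM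
    obtain ⟨y, rfl⟩ := hmin N hN
    exact layerDim_agreeSet_congr _ _ _

end AbelianArrangement

/-! ### Divisibility of characteristic polynomials -/

section Divisibility

/-- Divisibility of characteristic polynomials of posets corresponds to a factor `t ^ g - d` for
arrangements. In the second case (the rank drops on deletion) the factor forces `d = 0`, because
`q` has nonzero constant term. -/
theorem dvd_iff_exists_expand {g : ℕ} (hg : 0 < g) {p q : ℤ[X]} (hp : p.Monic) (hq : q.Monic)
    (hq0 : q.coeff 0 ≠ 0) {D' D : ℕ}
    (h : (D' = D ∧ p.natDegree = q.natDegree + 1) ∨ (D' = D + g ∧ p.natDegree = q.natDegree)) :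
    q ∣ p ↔ ∃ d : ℤ, X ^ D' * expand ℤ g p = (X ^ g - C d) * (X ^ D * expand ℤ g q) := by
  have hX : ∀ d : ℤ, (X ^ g - C d : ℤ[X]) = expand ℤ g (X - C d) := fun d => by simp
  constructor
  · rintro ⟨r, rfl⟩
    have hr : r.Monic := hq.of_mul_monic_left hp
    rw [hq.natDegree_mul hr] at h
    rcases h with ⟨rfl, hdeg⟩ | ⟨rfl, hdeg⟩
    · have hr1 : r = X + C (r.coeff 0) := hr.eq_X_add_C (by omega)
      refine ⟨-r.coeff 0, ?_⟩
      have : (X - C (-r.coeff 0) : ℤ[X]) = r := by rw [C_neg, sub_neg_eq_add]; exact hr1.symm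
      rw [hX, this, map_mul]
      ring
    · have hr1 : r = 1 := hr.natDegree_eq_zero.1 (by omega)
      refine ⟨0, ?_⟩
      rw [hr1, mul_one, C_0, sub_zero, pow_add]
      ring
  · rintro ⟨d, hd⟩
    have hXD : (X ^ D : ℤ[X]) ≠ 0 := pow_ne_zero _ X_ne_zero
    rw [hX, mul_left_comm, ← map_mul] at hd
    rcases h with ⟨rfl, -⟩ | ⟨rfl, -⟩
    · have := expand_injective hg (mul_left_cancel₀ hXD hd)
      exact ⟨X - C d, by rw [this, mul_comm]⟩
    · rw [pow_add, mul_assoc] at hd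
      have hd' := mul_left_cancel₀ hXD hd
      have hXg : (X ^ g : ℤ[X]) = expand ℤ g X := by simp
      rw [hXg, ← map_mul] at hd'
      have heq := expand_injective hg hd'
      have h0 := congrArg (fun r => coeff r 0) heq
      simp only [mul_coeff_zero, coeff_X_zero, zero_mul, coeff_sub, coeff_C_zero, zero_sub] at h0
      have hd0 : d = 0 := neg_eq_zero.1 ((mul_eq_zero.1 h0.symm).resolve_right hq0)
      rw [hd0, C_0, sub_zero] at heq
      rw [mul_left_cancel₀ X_ne_zero heq]

variable {T : Type u} [AddCommGroup T] [TopologicalSpace T] [IsTopologicalAddGroup T]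
  {g : ℕ} {E H : Set T} {𝓐 : Set (Set T)}

namespace IsGeometricArrangement

theorem restriction_dvd_iff (h : IsGeometricArrangement g E 𝓐) (hH : H ∈ 𝓐)
    (hres : IsGeometricArrangement g H (arrRestriction 𝓐 H)) :
    posetCharPoly (LayerPoset H (arrRestriction 𝓐 H)) ∣ posetCharPoly (LayerPoset E 𝓐) ↔
      ∃ d : ℤ, arrCharPoly E 𝓐 = (X ^ g - C d) * arrCharPoly H (arrRestriction 𝓐 H) := by
  obtain ⟨M, hM⟩ := hres.exists_isMinimalLayer
  have hM' := hM.of_arrRestriction hH (h.subset_base H hH)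
  obtain ⟨hp, hpdeg⟩ := h.isGeomRank.posetCharPoly_monic
  obtain ⟨hq, hqdeg⟩ := hres.isGeomRank.posetCharPoly_monic
  rw [h.arrCharPoly_eq hM', hres.arrCharPoly_eq hM]
  refine dvd_iff_exists_expand h.pos hp hq hres.isGeomRank.posetCharPoly_coeff_zero
    (Or.inl ⟨rfl, ?_⟩)
  have h1 := h.dim_eq_of_isMinimalLayer hM'
  have h2 := hres.dim_eq_of_isMinimalLayer hM
  have h3 := h.dim_base_of_mem hH
  rw [hpdeg, hqdeg]
  apply Nat.eq_of_mul_eq_mul_right h.pos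
  rw [add_mul, one_mul]
  omega

theorem restriction_dvd_deletion_iff (h : IsGeometricArrangement g E 𝓐) (hH : H ∈ 𝓐)
    (hres : IsGeometricArrangement g H (arrRestriction 𝓐 H))
    (hdel : IsGeometricArrangement g E (𝓐 \ {H})) :
    posetCharPoly (LayerPoset H (arrRestriction 𝓐 H)) ∣
        posetCharPoly (LayerPoset E (𝓐 \ {H})) ↔
      ∃ d : ℤ, arrCharPoly E (𝓐 \ {H}) =
        (X ^ g - C d) * arrCharPoly H (arrRestriction 𝓐 H) := by
  obtain ⟨M, hM⟩ := hres.exists_isMinimalLayer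
  obtain ⟨N, hN⟩ := hdel.exists_isMinimalLayer
  have hM' := hM.of_arrRestriction hH (h.subset_base H hH)
  obtain ⟨hp, hpdeg⟩ := hdel.isGeomRank.posetCharPoly_monic
  obtain ⟨hq, hqdeg⟩ := hres.isGeomRank.posetCharPoly_monic
  rw [hdel.arrCharPoly_eq hN, hres.arrCharPoly_eq hM]
  refine dvd_iff_exists_expand h.pos hp hq hres.isGeomRank.posetCharPoly_coeff_zero ?_
  have h1 := hdel.dim_eq_of_isMinimalLayer hN
  have h2 := hres.dim_eq_of_isMinimalLayer hM
  have h3 := h.dim_base_of_mem hH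
  rw [hpdeg, hqdeg]
  rcases h.isMinimalLayer_or_of_deletion hH hN with hN' | ⟨N', hN', hdim⟩
  · have hMN := h.dim_minimal M N hM' hN'
    refine Or.inl ⟨hMN.symm, Nat.eq_of_mul_eq_mul_right h.pos ?_⟩
    rw [add_mul, one_mul]
    omega
  · have hMN := h.dim_minimal M N' hM' hN'
    refine Or.inr ⟨by omega, Nat.eq_of_mul_eq_mul_right h.pos ?_⟩
    omega

theorem subsingleton_iff (h : IsGeometricArrangement g E 𝓐) :
    Subsingleton (LayerPoset E 𝓐) ↔ 𝓐 = ∅ := by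
  constructor
  · intro hs
    refine Set.eq_empty_of_forall_notMem fun K hK => h.not_base_subset K hK ?_
    have : LayerPoset.mk K (h.mem_layers hK) = LayerPoset.mk E h.base_mem := hs.elim _ _
    exact (congrArg Subtype.val this).ge
  · rintro rfl
    have key : ∀ Y : LayerPoset E (∅ : Set (Set T)), Y = LayerPoset.mk E h.base_mem := by
      intro Y
      by_contra hne
      obtain ⟨K, hK, -⟩ := exists_separating_mem Y.2 h.base_mem (subset_of_mem_layers Y.2)
        (fun he => hne (Subtype.ext he))
      exact hK
    exact ⟨fun Y Z => (key Y).trans (key Z).symm⟩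

theorem posetCharPoly_orderIso (h : IsGeometricArrangement g E 𝓐) {Q : Type v} [PartialOrder Q]
    (e : LayerPoset E 𝓐 ≃o Q) : posetCharPoly (LayerPoset E 𝓐) = posetCharPoly Q :=
  have := h.isGeomRank.finite
  _root_.posetCharPoly_orderIso h.isGeomRank.exists_bot e

theorem mem_atomSet (h : IsGeometricArrangement g E 𝓐) (Y : LayerPoset E 𝓐) :
    Y ∈ atomSet (LayerPoset E 𝓐) ↔ Y.1 ∈ 𝓐 := by
  rw [h.isGeomRank.atomSet_eq]; rfl

end IsGeometricArrangement

end Divisibility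

/-! ### Comparison of the inductive classes -/

section Classes

variable {Γ : Type v} {G : Type w} [AddCommGroup Γ] [AddCommGroup G] [TopologicalSpace G]
  [IsTopologicalAddGroup G] [Module.Finite ℤ Γ]
  {E : Set (Ambient Γ G)} {𝓐 : Set (Set (Ambient Γ G))}

theorem IsAbelianArrangementIn.mono (hG : HasExpCover G) (h : IsAbelianArrangementIn E 𝓐)
    {𝓑 : Set (Set (Ambient Γ G))} (h𝓑 : 𝓑 ⊆ 𝓐) : IsAbelianArrangementIn E 𝓑 := by
  obtain ⟨Λ, φ₀, hp⟩ := hG.isAbelianArrangementIn_iff.1 h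
  exact hG.isAbelianArrangementIn_iff.2 ⟨Λ, φ₀, hp.mono h𝓑⟩

theorem IsAbelianArrangementIn.arrRestriction (hG : HasExpCover G)
    (h : IsAbelianArrangementIn E 𝓐) {H : Set (Ambient Γ G)} (hH : H ∈ 𝓐) :
    IsAbelianArrangementIn H (arrRestriction 𝓐 H) := by
  obtain ⟨Λ, φ₀, hp⟩ := hG.isAbelianArrangementIn_iff.1 h
  exact hG.isAbelianArrangementIn_iff.2 (hp.arrRestriction hG hH)

theorem IsAbelianArrangementIn.isGeometricArrangement [Nontrivial G] (hG : HasExpCover G)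
    (h : IsAbelianArrangementIn E 𝓐) : IsGeometricArrangement (lieDim G) E 𝓐 := by
  obtain ⟨Λ, φ₀, hp⟩ := hG.isAbelianArrangementIn_iff.1 h
  exact hp.isGeometricArrangement hG

variable [Nontrivial G]

theorem IsInductiveArrangement.isInductivePoset (hG : HasExpCover G)
    (h : IsInductiveArrangement E 𝓐) (Q : Type (max v w)) [PartialOrder Q]
    (e : Q ≃o LayerPoset E 𝓐) : IsInductivePoset Q := by
  induction h generalizing Q with
  | empty E hE =>
    have hg := hE.isGeometricArrangement hG
    have := hg.subsingleton_iff.2 rfl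
    have : Subsingleton Q := e.toEquiv.subsingleton
    have : Nonempty Q := ⟨e.symm (.mk E hg.base_mem)⟩
    exact .trivial Q
  | step E 𝓐 h𝓐 H hH hres hdel d hχ ihres ihdel =>
    have hg := h𝓐.isGeometricArrangement hG
    have hgres := (h𝓐.arrRestriction hG hH).isGeometricArrangement hG
    have hgdel := (h𝓐.mono hG (𝓑 := 𝓐 \ {H}) Set.sdiff_subset).isGeometricArrangement hG
    have e1 := (restrictionOrderIso hH (hg.subset_base H hH) (hg.mem_layers hH)).trans
      (iciOrderIso e.symm _)
    have e2 := (hg.deletionOrderIso hH).trans (posetDeletionOrderIso e.symm _)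
    refine .step Q (hg.isGeomRank.of_orderIso e).isLocallyGeometric
      (e.symm (.mk H (hg.mem_layers hH))) ?_ (ihres _ e1.symm) (ihdel _ e2.symm) ?_
    · rw [mem_atomSet_orderIso, hg.mem_atomSet]
      exact hH
    · rw [← hgres.posetCharPoly_orderIso e1, ← hgdel.posetCharPoly_orderIso e2]
      exact (hg.restriction_dvd_deletion_iff hH hgres hgdel).2 ⟨d, hχ⟩

theorem IsInductivePoset.isInductiveArrangement (hG : HasExpCover G) {P : Type (max v w)}
    [PartialOrder P] (h : IsInductivePoset P) (E : Set (Ambient Γ G))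
    (𝓐 : Set (Set (Ambient Γ G))) (h𝓐 : IsAbelianArrangementIn E 𝓐)
    (e : P ≃o LayerPoset E 𝓐) : IsInductiveArrangement E 𝓐 := by
  induction h generalizing E 𝓐 with
  | trivial P =>
    have hg := h𝓐.isGeometricArrangement hG
    obtain rfl := hg.subsingleton_iff.1 e.symm.toEquiv.subsingleton
    exact .empty E h𝓐
  | step P hP a ha hres hdel hdvd ihres ihdel =>
    have hg := h𝓐.isGeometricArrangement hG
    have hH : (e a).1 ∈ 𝓐 := (hg.mem_atomSet _).1 ((mem_atomSet_orderIso e a).2 ha)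
    have hares := h𝓐.arrRestriction hG hH
    have hadel := h𝓐.mono hG (𝓑 := 𝓐 \ {(e a).1}) Set.sdiff_subset
    have hgres := hares.isGeometricArrangement hG
    have hgdel := hadel.isGeometricArrangement hG
    have e1 := (iciOrderIso e a).trans
      (restrictionOrderIso hH (hg.subset_base _ hH) (hg.mem_layers hH)).symm
    have e2 := (posetDeletionOrderIso e a).trans (hg.deletionOrderIso hH).symm
    rw [← hgres.posetCharPoly_orderIso e1.symm, ← hgdel.posetCharPoly_orderIso e2.symm] at hdvd
    obtain ⟨d, hd⟩ := (hg.restriction_dvd_deletion_iff hH hgres hgdel).1 hdvd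
    exact .step E 𝓐 h𝓐 _ hH (ihres _ _ hares e1) (ihdel _ _ hadel e2) d hd

theorem IsDivisionalArrangement.isDivisionalPoset (hG : HasExpCover G)
    (h : IsDivisionalArrangement E 𝓐) (Q : Type (max v w)) [PartialOrder Q]
    (e : Q ≃o LayerPoset E 𝓐) : IsDivisionalPoset Q := by
  induction h generalizing Q with
  | empty E hE =>
    have hg := hE.isGeometricArrangement hG
    have := hg.subsingleton_iff.2 rfl
    have : Subsingleton Q := e.toEquiv.subsingleton
    have : Nonempty Q := ⟨e.symm (.mk E hg.base_mem)⟩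
    exact .trivial Q
  | step E 𝓐 h𝓐 H hH hres d hχ ihres =>
    have hg := h𝓐.isGeometricArrangement hG
    have hgres := (h𝓐.arrRestriction hG hH).isGeometricArrangement hG
    have e1 := (restrictionOrderIso hH (hg.subset_base H hH) (hg.mem_layers hH)).trans
      (iciOrderIso e.symm _)
    refine .step Q (hg.isGeomRank.of_orderIso e).isLocallyGeometric
      (e.symm (.mk H (hg.mem_layers hH))) ?_ (ihres _ e1.symm) ?_
    · rw [mem_atomSet_orderIso, hg.mem_atomSet]
      exact hH
    · rw [← hgres.posetCharPoly_orderIso e1, ← hg.posetCharPoly_orderIso e.symm]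
      exact (hg.restriction_dvd_iff hH hgres).2 ⟨d, hχ⟩

theorem IsDivisionalPoset.isDivisionalArrangement (hG : HasExpCover G) {P : Type (max v w)}
    [PartialOrder P] (h : IsDivisionalPoset P) (E : Set (Ambient Γ G))
    (𝓐 : Set (Set (Ambient Γ G))) (h𝓐 : IsAbelianArrangementIn E 𝓐)
    (e : P ≃o LayerPoset E 𝓐) : IsDivisionalArrangement E 𝓐 := by
  induction h generalizing E 𝓐 with
  | trivial P =>
    have hg := h𝓐.isGeometricArrangement hG
    obtain rfl := hg.subsingleton_iff.1 e.symm.toEquiv.subsingleton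
    exact .empty E h𝓐
  | step P hP a ha hres hdvd ihres =>
    have hg := h𝓐.isGeometricArrangement hG
    have hH : (e a).1 ∈ 𝓐 := (hg.mem_atomSet _).1 ((mem_atomSet_orderIso e a).2 ha)
    have hares := h𝓐.arrRestriction hG hH
    have hgres := hares.isGeometricArrangement hG
    have e1 := (iciOrderIso e a).trans
      (restrictionOrderIso hH (hg.subset_base _ hH) (hg.mem_layers hH)).symm
    rw [← hgres.posetCharPoly_orderIso e1.symm, ← hg.posetCharPoly_orderIso e.symm] at hdvd
    obtain ⟨d, hd⟩ := (hg.restriction_dvd_iff hH hgres).1 hdvd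
    exact .step E 𝓐 h𝓐 _ hH (ihres _ _ hares e1) d hd

end Classes

/-! ### The trivial group -/

section TrivialGroup

theorem isAbelianArrangementIn_univ {Γ : Type v} {G : Type w} [AddCommGroup Γ] [AddCommGroup G]
    [Module.Free ℤ Γ] [TopologicalSpace G] (𝒜 : Finset (Γ × G)) (h𝒜 : ∀ p ∈ 𝒜, p.1 ≠ 0) :
    IsAbelianArrangementIn Set.univ (abelianArrangement 𝒜) := by
  refine ⟨⊥, 0, 𝒜, fun n γ hn h => ?_, ?_, fun p hp h => h𝒜 p hp h, ?_⟩
  · exact (smul_eq_zero.1 (show n • γ = 0 from h)).resolve_left hn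
  · refine (Set.eq_univ_of_forall fun φ γ hγ => ?_).symm
    rw [show γ = 0 from hγ, map_zero, map_zero]
  · simp only [Set.univ_inter]
    rfl

variable {Γ : Type v} {G : Type w} [AddCommGroup Γ] [AddCommGroup G] [TopologicalSpace G]
  [Subsingleton G]

instance : Subsingleton (Ambient Γ G) :=
  ⟨fun _ _ => DFunLike.ext _ _ fun _ => Subsingleton.elim _ _⟩

theorem eq_univ_of_mem_layers {𝓐 : Set (Set (Ambient Γ G))} {Y : Set (Ambient Γ G)}
    (hY : Y ∈ layers Set.univ 𝓐) : Y = Set.univ :=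
  Subsingleton.eq_univ_of_nonempty (nonempty_of_mem_layers hY)

instance (𝓐 : Set (Set (Ambient Γ G))) : Unique (LayerPoset Set.univ 𝓐) where
  default := .mk Set.univ (base_mem_layers Set.subsingleton_univ.isPreconnected Set.univ_nonempty)
  uniq Y := Subtype.ext (eq_univ_of_mem_layers Y.2)

variable [IsTopologicalAddGroup G]

theorem arrCharPoly_univ_congr (𝓐 𝓑 : Set (Set (Ambient Γ G))) :
    arrCharPoly Set.univ 𝓐 = arrCharPoly Set.univ 𝓑 := by
  have hbot : ∃ b : LayerPoset Set.univ 𝓐, IsBot b :=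
    ⟨default, fun Y => (Subsingleton.elim _ _).le⟩
  have hmu := moebiusBot_orderIso hbot
    (OrderIso.ofUnique (LayerPoset Set.univ 𝓐) (LayerPoset Set.univ 𝓑)) default
  rw [arrCharPoly, arrCharPoly, finsum_unique, finsum_unique, ← hmu]
  rfl

theorem lieDim_eq_zero : lieDim G = 0 := by
  have : Subsingleton (LieAlg G) :=
    ⟨fun _ _ => LieAlg.ext fun _ => Subsingleton.elim _ _⟩
  exact Module.finrank_zero_of_subsingleton

/-- Over the trivial group the only possible member of an arrangement is the ambient point, which
may be deleted with `t ^ 0 - 0 = 1` as factor. -/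
theorem isInductiveArrangement_and_isDivisionalArrangement {𝓐 : Set (Set (Ambient Γ G))}
    (h𝓐 : IsAbelianArrangementIn Set.univ 𝓐)
    (h0 : IsAbelianArrangementIn Set.univ (∅ : Set (Set (Ambient Γ G)))) :
    IsInductiveArrangement Set.univ 𝓐 ∧ IsDivisionalArrangement Set.univ 𝓐 := by
  have huniv : ∀ K ∈ 𝓐, K = Set.univ := by
    obtain ⟨Λ, φ₀, 𝒜, -, -, -, rfl⟩ := h𝓐
    rintro K ⟨p, -, x, hx, rfl⟩
    exact Subsingleton.eq_univ_of_nonempty ⟨x, mem_connectedComponentIn hx⟩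
  rcases 𝓐.eq_empty_or_nonempty with rfl | ⟨K, hK⟩
  · exact ⟨.empty _ h0, .empty _ h0⟩
  · have hmem : Set.univ ∈ 𝓐 := huniv K hK ▸ hK
    have hdel : 𝓐 \ {Set.univ} = ∅ := by
      ext K
      simpa using huniv K
    have hres : arrRestriction 𝓐 Set.univ = ∅ := by
      refine Set.eq_empty_of_forall_notMem ?_
      rintro D ⟨K, hK, -⟩
      exact hK.2 (huniv K hK.1)
    have hone : ((X : ℤ[X]) ^ lieDim G - C 0) = 1 := by simp [lieDim_eq_zero]
    refine ⟨.step _ _ h𝓐 _ hmem ?_ ?_ 0 ?_, .step _ _ h𝓐 _ hmem ?_ 0 ?_⟩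
    · rw [hres]; exact .empty _ h0
    · rw [hdel]; exact .empty _ h0
    · rw [hone, one_mul]; exact arrCharPoly_univ_congr _ _
    · rw [hres]; exact .empty _ h0
    · rw [hone, one_mul]; exact arrCharPoly_univ_congr _ _

end TrivialGroup

theorem theorem5p5 {Γ : Type v} [AddCommGroup Γ] [Module.Free ℤ Γ] [Module.Finite ℤ Γ]
    {G : Type w} [AddCommGroup G] [TopologicalSpace G] [IsTopologicalAddGroup G]
    (a b : ℕ) (e : G ≃ₜ+ (Fin a → UnitAddCircle) × (Fin b → ℝ)) :
    (∀ 𝒜 : Finset (Γ × G), (∀ p ∈ 𝒜, p.1 ≠ 0) →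
      (IsInductiveArrangement Set.univ (abelianArrangement 𝒜) ↔
        IsInductivePoset (LayerPoset Set.univ (abelianArrangement 𝒜))) ∧
      (IsDivisionalArrangement Set.univ (abelianArrangement 𝒜) ↔
        IsDivisionalPoset (LayerPoset Set.univ (abelianArrangement 𝒜)))) ∧
    (∀ 𝒜₁ 𝒜₂ : Finset (Γ × G), (∀ p ∈ 𝒜₁, p.1 ≠ 0) → (∀ p ∈ 𝒜₂, p.1 ≠ 0) →
      Nonempty (LayerPoset Set.univ (abelianArrangement 𝒜₁) ≃o
        LayerPoset Set.univ (abelianArrangement 𝒜₂)) →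
      (IsInductiveArrangement Set.univ (abelianArrangement 𝒜₁) ↔
        IsInductiveArrangement Set.univ (abelianArrangement 𝒜₂)) ∧
      (IsDivisionalArrangement Set.univ (abelianArrangement 𝒜₁) ↔
        IsDivisionalArrangement Set.univ (abelianArrangement 𝒜₂))) := by
  have hG := hasExpCover_of_equiv a b e
  rcases subsingleton_or_nontrivial G with hs | hn
  · have key : ∀ 𝒜 : Finset (Γ × G), (∀ p ∈ 𝒜, p.1 ≠ 0) →
        IsInductiveArrangement Set.univ (abelianArrangement 𝒜) ∧
          IsDivisionalArrangement Set.univ (abelianArrangement 𝒜) := fun 𝒜 h𝒜 => by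
      have h := isAbelianArrangementIn_univ 𝒜 h𝒜
      exact isInductiveArrangement_and_isDivisionalArrangement h
        (h.mono hG (Set.empty_subset _))
    refine ⟨fun 𝒜 h𝒜 => ⟨iff_of_true (key 𝒜 h𝒜).1 (.trivial _),
      iff_of_true (key 𝒜 h𝒜).2 (.trivial _)⟩, fun 𝒜₁ 𝒜₂ h₁ h₂ _ =>
      ⟨iff_of_true (key 𝒜₁ h₁).1 (key 𝒜₂ h₂).1, iff_of_true (key 𝒜₁ h₁).2 (key 𝒜₂ h₂).2⟩⟩
  · refine ⟨fun 𝒜 h𝒜 => ?_, fun 𝒜₁ 𝒜₂ h₁ h₂ => ?_⟩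
    · have h := isAbelianArrangementIn_univ 𝒜 h𝒜
      exact ⟨⟨fun hA => hA.isInductivePoset hG _ (OrderIso.refl _),
          fun hP => hP.isInductiveArrangement hG _ _ h (OrderIso.refl _)⟩,
        ⟨fun hA => hA.isDivisionalPoset hG _ (OrderIso.refl _),
          fun hP => hP.isDivisionalArrangement hG _ _ h (OrderIso.refl _)⟩⟩
    · rintro ⟨f⟩
      have hA₁ := isAbelianArrangementIn_univ 𝒜₁ h₁
      have hA₂ := isAbelianArrangementIn_univ 𝒜₂ h₂
      exact ⟨⟨fun hA => (hA.isInductivePoset hG _ f.symm).isInductiveArrangement hG _ _ hA₂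
            (OrderIso.refl _),
          fun hA => (hA.isInductivePoset hG _ f).isInductiveArrangement hG _ _ hA₁
            (OrderIso.refl _)⟩,
        ⟨fun hA => (hA.isDivisionalPoset hG _ f.symm).isDivisionalArrangement hG _ _ hA₂
            (OrderIso.refl _),
          fun hA => (hA.isDivisionalPoset hG _ f).isDivisionalArrangement hG _ _ hA₁
            (OrderIso.refl _)⟩⟩
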